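/- Let $n\ge 3$, $d=n+1$, and let $M$ be a compact smooth $d$-manifold with boundary $\Sigma$ and interior $M_+=M\setminus\Sigma$, carrying a Poincaré–Einstein structure: a smooth Riemannian metric $g$ on $M$ and a smooth function $x\ge 0$ with zero set $\Sigma$ and $dx\ne0$ along $\Sigma$, such that $g_+=x^{-2}g$ satisfies $\operatorname{Ric}(g_+)=-n\,g_+$ on $M_+$. Laplacians are $\Delta=-\nabla^a\nabla_a$. On $M_+$ with the conformal class $[g]$, let $\mathcal E[w]$ be the space of smooth densities of weight $w$: a density $u$ assigns to each metric $g'\in[g]$ a smooth function $u_{g'}$, with $u_{\Omega^2g'}=\Omega^w u_{g'}$ for every smooth $\Omega>0$. Let $\sigma\in\mathcal E[1]$ be the Einstein scale, with $\sigma_{g_+}=1$ (so $\sigma_g=x$). In a metric of $[g]$, with Schouten tensor $P_{ab}$ (where $\operatorname{Ric}=(d-2)P+Jg$, $J=\operatorname{tr}P$), a standard tractor is a triple $(\sigma,\mu_a,\rho)$, a section of $\mathcal E[1]\oplus\mathcal E_a[1]\oplus\mathcal E[-1]$, the tractor metric is the polarisation of $h(U,U)=2\rho\sigma+\mu^a\mu_a$,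 the tractor connection is $$\nabla_a(\sigma,\mu_b,\rho)=(\nabla_a\sigma-\mu_a,\ \nabla_a\mu_b+g_{ab}\rho+P_{ab}\sigma,\ \nabla_a\rho-P_{ac}\mu^c),$$ extended to tensor powers by the Leibniz rule and coupled with the Levi-Civita connection, and on tensor tractors $V$ of weight $w$ the tractor-$D$ operator, written as a triple in the new index $A$, is $$D_AV=\big((d+2w-2)wV,\ (d+2w-2)\nabla_aV,\ (\Delta-wJ)V\big).$$ Let $I=\frac1dD\sigma$ and let $\Box=\Delta-(1-\frac d2)J$ (tractor coupled). For even $k\ge2$ define, for $u\in\mathcal E[\frac{k-d}2]$, $$P_ku=\sigma^{1-k/2}\,I^{A_2}\cdots I^{A_{k/2}}\,\Box\, D_{A_2}\cdots D_{A_{k/2}}u .$$ **Proposition.** On the interior $M_+$, for every even $k\ge2$, $$\mathcal N(P_k)=\bigoplus_{i=1}^{k/2}\mathcal N\big(\Delta^{g_+}-s_i(n-s_i)\big),\qquad s_i=\frac{k+n+1-2i}{2}.$$ Here $\mathcal N(P_k)\subset\mathcal E[\frac{k-d}2]$ is the linear subspace of the densities $u$ such that $P_ku=0$ in every metric of the conformal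 class, $\mathcal N(\Delta^{g_+}-s_i(n-s_i))$ is the linear subspace of the $u\in\mathcal E[\frac{k-d}2]$ for which the function $u_{g_+}=\sigma^{-(k-d)/2}u$ on $M_+$ satisfies $\Delta^{g_+}u_{g_+}=s_i(n-s_i)u_{g_+}$, and the sum is an internal direct sum. -/

import Mathlib

open scoped Manifold ContDiff

noncomputable section

/-! ## Riemannian geometry and tractor calculus in local coordinates

`d` is the dimension.  All fields are given by their components on (an open part of) `ℝ^d`; only
the germ of a field at a point matters for the derivatives below. -/

namespace TractorCalculus

variable {d : ℕ}

/-- The coordinate space `ℝ^d`. -/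
abbrev Coord (d : ℕ) : Type := EuclideanSpace ℝ (Fin d)

/-- The components `γ_{ab}` of a metric in coordinates. -/
abbrev MetricField (d : ℕ) : Type := Coord d → Matrix (Fin d) (Fin d) ℝ

/-- The `a`-th standard basis vector of `ℝ^d`. -/
def stdVec (a : Fin d) : Coord d := EuclideanSpace.single a 1

/-- The partial derivative `∂_a f`. -/
def pd (a : Fin d) (f : Coord d → ℝ) (y : Coord d) : ℝ := fderiv ℝ f y (stdVec a)

/-- The Christoffel symbols `Γ^c_{ab}` of the Levi-Civita connection of `γ`. -/
def christoffel (γ : MetricField d) (c a b : Fin d) (y : Coord d) : ℝ :=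
  (1 / 2) * ∑ e, (γ y)⁻¹ c e *
    (pd a (fun z => γ z b e) y + pd b (fun z => γ z a e) y - pd e (fun z => γ z a b) y)

/-- The Riemann curvature `R_{ab}{}^c{}_e`, with `(∇_a ∇_b - ∇_b ∇_a) V^c = R_{ab}{}^c{}_e V^e`. -/
def riemann (γ : MetricField d) (a b c e : Fin d) (y : Coord d) : ℝ :=
  pd a (christoffel γ c b e) y - pd b (christoffel γ c a e) y
    + ∑ f, (christoffel γ c a f y * christoffel γ f b e y
      - christoffel γ c b f y * christoffel γ f a e y)

/-- The Ricci curvature `Ric_{ab} = R_{ca}{}^c{}_b`. -/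
def ricci (γ : MetricField d) (a b : Fin d) (y : Coord d) : ℝ :=
  ∑ c, riemann γ c a c b y

/-- The scalar curvature. -/
def scalarCurvature (γ : MetricField d) (y : Coord d) : ℝ :=
  ∑ a, ∑ b, (γ y)⁻¹ a b * ricci γ a b y

/-- The trace `J` of the Schouten tensor: tracing `Ric = (d - 2) P + J γ` gives
`Sc = 2 (d - 1) J`. -/
def schoutenTrace (γ : MetricField d) (y : Coord d) : ℝ :=
  scalarCurvature γ y / (2 * ((d : ℝ) - 1))

/-- The Schouten tensor `P_{ab}`, determined by `Ric = (d - 2) P + J γ`. -/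
def schouten (γ : MetricField d) (a b : Fin d) (y : Coord d) : ℝ :=
  (ricci γ a b y - schoutenTrace γ y * γ y a b) / ((d : ℝ) - 2)

/-- The Laplacian of functions, `Δ f = - γ^{ab} ∇_a ∇_b f`. -/
def laplaceBeltrami (γ : MetricField d) (f : Coord d → ℝ) (y : Coord d) : ℝ :=
  - ∑ a, ∑ b, (γ y)⁻¹ a b * (pd a (pd b f) y - ∑ c, christoffel γ c a b y * pd c f y)

/-- The index set of the standard tractor bundle `E[1] ⊕ E_a[1] ⊕ E[-1]` in a scale and in
coordinates: a standard tractor is a triple `(σ, μ_a, ρ)`, with `σ` in the slot `top`, the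
component `μ_a` in the slot `mid a`, and `ρ` in the slot `bot`. -/
inductive TractorIndex (d : ℕ) : Type
  | top : TractorIndex d
  | mid (a : Fin d) : TractorIndex d
  | bot : TractorIndex d
  deriving DecidableEq, Fintype

open TractorIndex

/-- A section of the `r`-fold tensor power of the standard tractor bundle, tensored with a density
bundle, in a scale and in coordinates.  Each index is written as a triple as above; indices are
raised and lowered with the tractor metric. -/
abbrev TractorField (d r : ℕ) : Type := (Fin r → TractorIndex d) → Coord d → ℝ

/-- The tractor metric on triples: `h(U, U') = σ ρ' + ρ σ' + γ^{ab} μ_a μ'_b`. -/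
def tractorMetric (γ : MetricField d) : TractorIndex d → TractorIndex d → Coord d → ℝ
  | top, bot, _ => 1
  | bot, top, _ => 1
  | mid a, mid b, y => (γ y)⁻¹ a b
  | _, _, _ => 0

/-- The connection coefficients of the (coupled Levi-Civita) tractor connection
`∇_a (σ, μ_b, ρ) = (∇_a σ - μ_a, ∇_a μ_b + γ_{ab} ρ + P_{ab} σ, ∇_a ρ - P_a{}^c μ_c)`:
the slot `A` of `∇_a U` is `∂_a U_A + ∑_B (tractorConn γ a A B) U_B`. -/
def tractorConn (γ : MetricField d) (a : Fin d) :
    TractorIndex d → TractorIndex d → Coord d → ℝ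
  | top, mid b, _ => if a = b then -1 else 0
  | mid b, top, y => schouten γ a b y
  | mid b, mid c, y => - christoffel γ c a b y
  | mid b, bot, y => γ y a b
  | bot, mid c, y => - ∑ e, schouten γ a e y * (γ y)⁻¹ e c
  | _, _, _ => 0

/-- The tractor connection `∇_a V` on (weighted) tensor tractors, extended by the Leibniz rule.
Densities are trivialised by the scale, and the Levi-Civita connection of the scale is the flat
connection of this trivialisation. -/
def tractorDeriv {r : ℕ} (γ : MetricField d) (a : Fin d) (V : TractorField d r) :
    TractorField d r := fun A y =>
  pd a (V A) y + ∑ s, ∑ B, tractorConn γ a (A s) B y * V (Function.update A s B) y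

/-- The coupled Laplacian `Δ V = - γ^{ab} ∇_a ∇_b V` on tensor tractors. -/
def tractorLaplacian {r : ℕ} (γ : MetricField d) (V : TractorField d r) :
    TractorField d r := fun A y =>
  - ∑ a, ∑ b, (γ y)⁻¹ a b * (tractorDeriv γ a (tractorDeriv γ b V) A y
      - ∑ c, christoffel γ c a b y * tractorDeriv γ c V A y)

/-- The Thomas tractor-D operator on tractors of weight `w`,
`D_A V = (d + 2w - 2) w Y_A V + (d + 2w - 2) Z_A^a ∇_a V + X_A (Δ - w J) V`;
the new index `A` is put in front. -/
def thomasD {r : ℕ} (γ : MetricField d) (w : ℝ) (V : TractorField d r) :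
    TractorField d (r + 1) := fun A y =>
  match A 0 with
  | top => (d + 2 * w - 2) * w * V (Fin.tail A) y
  | mid a => (d + 2 * w - 2) * tractorDeriv γ a V (Fin.tail A) y
  | bot => tractorLaplacian γ V (Fin.tail A) y - w * schoutenTrace γ y * V (Fin.tail A) y

/-- The iterate `D_{A_1} ⋯ D_{A_m} u` on a density `u` of weight `w`.  Each factor lowers the
weight by one, so the `j`-th factor to act does so on a tractor of weight `w - (j - 1)`. -/
def iterThomasD (γ : MetricField d) (w : ℝ) (u : Coord d → ℝ) : (m : ℕ) → TractorField d m
  | 0 => fun _ => u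
  | m + 1 => thomasD γ (w - m) (iterThomasD γ w u m)

/-- The tractor-coupled Yamabe operator `□ = Δ - (1 - d/2) J`. -/
def tractorYamabe {r : ℕ} (γ : MetricField d) (V : TractorField d r) : TractorField d r :=
  fun A y => tractorLaplacian γ V A y - (1 - (d : ℝ) / 2) * schoutenTrace γ y * V A y

/-- The tractor `I = (1/d) D σ` of a density `σ` of weight one. -/
def scaleTractor (γ : MetricField d) (σ : Coord d → ℝ) (A : TractorIndex d) (y : Coord d) : ℝ :=
  (1 / (d : ℝ)) * thomasD γ 1 (fun _ : Fin 0 → TractorIndex d => σ) (fun _ => A) y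

/-- The full contraction `I^{A_1} ⋯ I^{A_m} V_{A_1 ⋯ A_m}` by means of the tractor metric. -/
def contract {m : ℕ} (γ : MetricField d) (I : TractorIndex d → Coord d → ℝ)
    (V : TractorField d m) (y : Coord d) : ℝ :=
  ∑ A : Fin m → TractorIndex d, (∏ s, ∑ B, tractorMetric γ (A s) B y * I B y) * V A y

/-- The operator
`P_k u = σ^{1 - k/2} I^{A_2} ⋯ I^{A_{k/2}} □ D_{A_2} ⋯ D_{A_{k/2}} u`, with `I = (1/d) D σ`,
on densities `u` of weight `(k - d)/2` (`k` even), in the scale of the metric `γ`. -/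
def gjmsLocal (γ : MetricField d) (σ : Coord d → ℝ) (k : ℕ) (u : Coord d → ℝ) (y : Coord d) : ℝ :=
  σ y ^ (1 - ((k / 2 : ℕ) : ℤ)) *
    contract γ (scaleTractor γ σ)
      (tractorYamabe γ (iterThomasD γ (((k : ℝ) - d) / 2) u (k / 2 - 1))) y

end TractorCalculus

/-! ## Poincaré–Einstein manifolds -/

namespace PoincareEinstein

open TractorCalculus

variable (n : ℕ) (M : Type*) [TopologicalSpace M] [ChartedSpace (EuclideanHalfSpace (n + 1)) M]

/-- The interior `M_+` of a manifold with boundary of dimension `n + 1`, as an open subset. -/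
def interiorOpens [IsManifold (𝓡∂ (n + 1)) ∞ M] : TopologicalSpace.Opens M :=
  ⟨(𝓡∂ (n + 1)).interior M, ModelWithCorners.isOpen_interior (by simp : (∞ : ℕ∞ω) ≠ 0)⟩

/-- The part of the coordinate domain of the chart around `c` that corresponds to interior
points. -/
def interiorTarget (c : M) : Set (Coord (n + 1)) :=
  (extChartAt (𝓡∂ (n + 1)) c).target ∩ interior (Set.range (𝓡∂ (n + 1)))

variable {n M}

/-- The components `g_{ab} = g(∂_a, ∂_b)` of a metric in the chart around `c`. -/
def metricInChart [IsManifold (𝓡∂ (n + 1)) ∞ M]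
    (g : Bundle.ContMDiffRiemannianMetric (𝓡∂ (n + 1)) ∞ (EuclideanSpace ℝ (Fin (n + 1)))
      (fun p : M => TangentSpace (𝓡∂ (n + 1)) p)) (c : M) : MetricField (n + 1) := fun y =>
  Matrix.of fun a b =>
    g.inner ((extChartAt (𝓡∂ (n + 1)) c).symm y)
      (mfderivWithin 𝓘(ℝ, EuclideanSpace ℝ (Fin (n + 1))) (𝓡∂ (n + 1))
        (extChartAt (𝓡∂ (n + 1)) c).symm (Set.range (𝓡∂ (n + 1))) y (stdVec a))
      (mfderivWithin 𝓘(ℝ, EuclideanSpace ℝ (Fin (n + 1))) (𝓡∂ (n + 1))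
        (extChartAt (𝓡∂ (n + 1)) c).symm (Set.range (𝓡∂ (n + 1))) y (stdVec b))

variable (n M) in
/-- A Poincaré–Einstein structure on a manifold `M` with boundary, of dimension `n + 1`: a smooth
metric `g` on `M` and a non-negative defining function `x` for the boundary such that the
metric `g_+ = x⁻² g` on the interior satisfies `Ric(g_+) = - n g_+`. -/
structure Structure [IsManifold (𝓡∂ (n + 1)) ∞ M] where
  /-- The metric `g` on `M`. -/
  g : Bundle.ContMDiffRiemannianMetric (𝓡∂ (n + 1)) ∞ (EuclideanSpace ℝ (Fin (n + 1)))
    (fun p : M => TangentSpace (𝓡∂ (n + 1)) p)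
  /-- The defining function. -/
  x : C^∞⟮𝓡∂ (n + 1), M; 𝓘(ℝ, ℝ), ℝ⟯
  x_boundary : ∀ p ∈ (𝓡∂ (n + 1)).boundary M, x p = 0
  x_interior : ∀ p ∈ (𝓡∂ (n + 1)).interior M, 0 < x p
  dx_boundary : ∀ p ∈ (𝓡∂ (n + 1)).boundary M, mfderiv (𝓡∂ (n + 1)) 𝓘(ℝ, ℝ) x p ≠ 0
  einstein : ∀ c : M, ∀ y ∈ interiorTarget n M c, ∀ a b,
    ricci (fun z => (x ((extChartAt (𝓡∂ (n + 1)) c).symm z) ^ 2)⁻¹ • metricInChart g c z) a b y =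
      - (n : ℝ) * ((x ((extChartAt (𝓡∂ (n + 1)) c).symm y) ^ 2)⁻¹ • metricInChart g c y) a b

variable [IsManifold (𝓡∂ (n + 1)) ∞ M]

variable (n M) in
/-- Smooth real functions on the interior. -/
abbrev SmoothFun : Type _ := C^∞⟮𝓡∂ (n + 1), interiorOpens n M; 𝓘(ℝ, ℝ), ℝ⟯

variable (n M) in
/-- The scales on the interior: a smooth positive function `τ` stands for the metric `τ² g` in the
conformal class of `g` on `M_+`. -/
abbrev Scale : Type _ := {τ : SmoothFun n M // ∀ p, 0 < τ p}

variable (n M) in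
/-- The smooth conformal densities of weight `w` on the interior: the sections of `E[w]`.  A density
`u` assigns to each metric of the conformal class a function, with `u_{Ω² g'} = Ω^w u_{g'}`. -/
def Density (w : ℝ) : Submodule ℝ (Scale n M → SmoothFun n M) where
  carrier := {u | ∀ (τ τ' : Scale n M) p, u τ' p = (τ'.1 p / τ.1 p) ^ w * u τ p}
  zero_mem' := by intro τ τ' p; simp
  add_mem' := by
    intro u v hu hv τ τ' p
    simp only [Pi.add_apply, ContMDiffMap.coe_add]
    rw [hu τ τ' p, hv τ τ' p]; ring
  smul_mem' := by
    intro t u hu τ τ' p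
    simp only [Pi.smul_apply, ContMDiffMap.coe_smul, smul_eq_mul]
    rw [hu τ τ' p]; ring

open Classical in
/-- A function on the interior, in the coordinates of the chart around `c` (with the value `0` at
coordinates that do not correspond to interior points). -/
def inChart (c : M) (f : interiorOpens n M → ℝ) (y : Coord (n + 1)) : ℝ :=
  if h : (extChartAt (𝓡∂ (n + 1)) c).symm y ∈ interiorOpens n M then
    f ⟨(extChartAt (𝓡∂ (n + 1)) c).symm y, h⟩ else 0

namespace Structure

variable (S : Structure n M)

/-- The metric `τ² g` of the scale `τ`, in the chart around `c`. -/
def scaleMetric (τ : Scale n M) (c : M) : MetricField (n + 1) := fun y =>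
  (inChart c τ.1 y ^ 2) • metricInChart S.g c y

/-- The scale of the Einstein metric `g_+ = x⁻² g`. -/
def plusScale : Scale n M :=
  ⟨⟨fun p => (S.x p)⁻¹, by
      intro p
      exact ContMDiffAt.inv₀ ((S.x.contMDiff.comp contMDiff_subtype_val) p)
        (S.x_interior p.1 p.2).ne'⟩,
    fun p => inv_pos.2 (S.x_interior p.1 p.2)⟩

/-- The Einstein scale `σ`, a density of weight one with `g_+ = σ⁻² 𝐠`, where `𝐠` is the conformal
metric: it is `x` in the scale `g`, hence `τ x` in the scale `τ² g`, and `1` in the scale `g_+`. -/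
def einsteinScale : Density n M 1 :=
  ⟨fun τ => τ.1 * ⟨fun p => S.x p, S.x.contMDiff.comp contMDiff_subtype_val⟩, by
    intro τ τ' p
    have h := (τ.2 p).ne'
    change τ'.1 p * S.x p = (τ'.1 p / τ.1 p) ^ (1 : ℝ) * (τ.1 p * S.x p)
    rw [Real.rpow_one]
    field_simp⟩

/-- The value at `p`, in the scale `τ`, of `P_k u` for a density `u` of weight `(k - d)/2`,
`d = n + 1`, computed in the chart around `p`. -/
def gjms (k : ℕ) (u : Density n M (((k : ℝ) - ((n : ℝ) + 1)) / 2)) (τ : Scale n M)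
    (p : interiorOpens n M) : ℝ :=
  gjmsLocal (S.scaleMetric τ p.1) (inChart p.1 (S.einsteinScale.1 τ)) k (inChart p.1 (u.1 τ))
    (extChartAt (𝓡∂ (n + 1)) p.1 p.1)

/-- The Laplacian `Δ^{g_+} f` at `p`, computed in the chart around `p`. -/
def laplacianPlus (f : SmoothFun n M) (p : interiorOpens n M) : ℝ :=
  laplaceBeltrami (S.scaleMetric S.plusScale p.1) (inChart p.1 f)
    (extChartAt (𝓡∂ (n + 1)) p.1 p.1)

/-- The null space of `P_k` on the interior. -/
def gjmsNull (k : ℕ) : Set (Density n M (((k : ℝ) - ((n : ℝ) + 1)) / 2)) :=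
  {u | ∀ τ p, S.gjms k u τ p = 0}

/-- The null space of the scattering Laplacian `Δ^{g_+} - s (n - s)`, acting on densities of weight
`w` through their trivialisation by the Einstein scale (that is, on `u_{g_+} = σ^{-w} u`). -/
def scatteringNull (w s : ℝ) : Set (Density n M w) :=
  {u | ∀ p, S.laplacianPlus (u.1 S.plusScale) p - s * (n - s) * u.1 S.plusScale p = 0}

end Structure

end PoincareEinstein

end

/-! On the interior, $P_k$ is, up to powers of $\sigma$, an iterate of the scalar operator $I^AD_A$.
In the scale $g_+$ each factor of this iterate is the Laplacian plus a constant. The kernel of such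
a product splits into eigenspaces because the constants differ.

The tractor $I=\frac1dD\sigma$ has slots $(\sigma,d\sigma,\rho)$ with
$\rho=(1-|d\sigma|^2)/(2\sigma)$. The conformal change of Ricci (`ricci_conformalMetric`) turns the
Einstein equation for $\sigma^{-2}\gamma$ into
$P_{ab}=-\sigma^{-1}(\nabla_a\nabla_b\sigma+\rho\gamma_{ab})$ (`schouten_eq`). Differentiating
$\rho$ then gives $\nabla_a\rho=P_a{}^c\nabla_c\sigma$ (`pd_scaleBot`). Together these say that $I$
is parallel (`isParallelOn`). Contraction with $I$ therefore commutes with $\nabla$, $\Delta$ and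
$D$, and $I^{A_1}\cdots I^{A_m}D_{A_1}\cdots D_{A_m}u$ equals $m$ scalar operators $I\cdot D$
applied in turn (`contractUpper_thomasD`).

On a density $\sigma^wf$ the operator $I\cdot D$ acts as $\sigma^{w-1}(\Delta^{g_+}+w(d+w-1))f$
(`contractedD_rpow_mul`). After $k/2-1$ factors the weight is $1-\frac d2$. There the coefficient
$d+2w-2$ vanishes and $I\cdot D$ becomes $\sigma\Box$, so the $\Box$ in $P_k$ supplies the last
factor. As $\sigma>0$ on $M_+$, the equation $P_ku=0$ is equivalent to
$\prod_j(\Delta^{g_+}+(w-j)(d+w-j-1))u_{g_+}=0$ with $0\le j<k/2$ and $w=\frac{k-d}2$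
(`gjmsLocal_eq_zero_iff`). With $s=w-j+n$ and $d=n+1$, the $j$-th constant is $-s(n-s)$.

The Laplacian at a point is computed in the chart around that point, so iterating it requires its
invariance under coordinate changes (`laplaceBeltrami_comp`). This makes $\Delta^{g_+}$ an
endomorphism of the smooth functions on $M_+$ (`laplacianOp`). Finally
$s_i(n-s_i)=\frac{n^2}4-(s_i-\frac n2)^2$, where the numbers $s_i-\frac n2=\frac{k+1-2i}2$ are
distinct and positive. The factors are thus coprime polynomials in $\Delta^{g_+}$, and the kernel of
their product is the direct sum of their kernels (`Module.End.ker_aeval_prod_X_sub_C`). -/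

noncomputable section

namespace TractorCalculus

variable {d : ℕ} {U : Set (Coord d)} {y : Coord d}

/-! ### Partial derivatives -/

lemma differentiableAt_of_smoothOn (hU : IsOpen U) {f : Coord d → ℝ} (hf : ContDiffOn ℝ ∞ f U)
    (hy : y ∈ U) : DifferentiableAt ℝ f y :=
  (hf.contDiffAt (hU.mem_nhds hy)).differentiableAt (by simp)

lemma smoothOn_pd (hU : IsOpen U) {f : Coord d → ℝ} (hf : ContDiffOn ℝ ∞ f U) (a : Fin d) :
    ContDiffOn ℝ ∞ (pd a f) U :=
  ((contDiffOn_infty_iff_fderiv_of_isOpen hU).1 hf).2.clm_apply contDiffOn_const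

lemma pd_congr_nhds {f g : Coord d → ℝ} (h : f =ᶠ[nhds y] g) (a : Fin d) :
    pd a f y = pd a g y := by
  simp [pd, h.fderiv_eq]

lemma pd_congr (hU : IsOpen U) {f g : Coord d → ℝ} (h : Set.EqOn f g U) (a : Fin d) :
    Set.EqOn (pd a f) (pd a g) U := fun _ hz =>
  pd_congr_nhds (h.eventuallyEq_of_mem (hU.mem_nhds hz)) a

@[simp] lemma pd_const (a : Fin d) (t : ℝ) : pd a (fun _ => t) y = 0 := by
  simp [pd]

lemma pd_add {f g : Coord d → ℝ} (hf : DifferentiableAt ℝ f y) (hg : DifferentiableAt ℝ g y)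
    (a : Fin d) : pd a (fun z => f z + g z) y = pd a f y + pd a g y := by
  simp [pd, fderiv_fun_add hf hg]

lemma pd_sub {f g : Coord d → ℝ} (hf : DifferentiableAt ℝ f y) (hg : DifferentiableAt ℝ g y)
    (a : Fin d) : pd a (fun z => f z - g z) y = pd a f y - pd a g y := by
  simp [pd, fderiv_fun_sub hf hg]

lemma pd_mul {f g : Coord d → ℝ} (hf : DifferentiableAt ℝ f y) (hg : DifferentiableAt ℝ g y)
    (a : Fin d) : pd a (fun z => f z * g z) y = pd a f y * g y + f y * pd a g y := by
  simp [pd, fderiv_fun_mul hf hg]; ring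

lemma pd_sum {ι : Type*} (s : Finset ι) {f : ι → Coord d → ℝ}
    (hf : ∀ i ∈ s, DifferentiableAt ℝ (f i) y) (a : Fin d) :
    pd a (fun z => ∑ i ∈ s, f i z) y = ∑ i ∈ s, pd a (f i) y := by
  simp [pd, fderiv_fun_sum hf]

lemma pd_sum_mul {ι : Type*} (s : Finset ι) {f g : ι → Coord d → ℝ}
    (hf : ∀ i, DifferentiableAt ℝ (f i) y) (hg : ∀ i, DifferentiableAt ℝ (g i) y) (a : Fin d) :
    pd a (fun z => ∑ i ∈ s, f i z * g i z) y
      = ∑ i ∈ s, (pd a (f i) y * g i y + f i y * pd a (g i) y) := by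
  rw [pd_sum s (fun i _ => (hf i).fun_mul (hg i))]
  exact Finset.sum_congr rfl fun i _ => pd_mul (hf i) (hg i) a

lemma pd_comp {f : Coord d → ℝ} {h : ℝ → ℝ} {h' : ℝ} (hh : HasDerivAt h h' (f y))
    (hf : DifferentiableAt ℝ f y) (a : Fin d) :
    pd a (fun z => h (f z)) y = h' * pd a f y := by
  have := (hh.comp_hasFDerivAt y hf.hasFDerivAt).fderiv
  simp only [pd]
  rw [show (fun z => h (f z)) = h ∘ f from rfl, this]
  simp

lemma two_le_infty : (2 : ℕ∞ω) ≤ ∞ := ENat.LEInfty.out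

lemma pd_comm (hU : IsOpen U) {f : Coord d → ℝ} (hf : ContDiffOn ℝ ∞ f U) (hy : y ∈ U)
    (a b : Fin d) : pd a (pd b f) y = pd b (pd a f) y := by
  have hf' := hf.contDiffAt (hU.mem_nhds hy)
  have hs := hf'.isSymmSndFDerivAt (by simpa using two_le_infty)
  have hd : DifferentiableAt ℝ (fderiv ℝ f) y :=
    (hf'.fderiv_right (m := 1) (one_add_one_eq_two.trans_le two_le_infty)).differentiableAt (by simp)
  have key : ∀ a b : Fin d, pd a (pd b f) y = fderiv ℝ (fderiv ℝ f) y (stdVec a) (stdVec b) := by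
    intro a b
    change fderiv ℝ (fun z => fderiv ℝ f z (stdVec b)) y (stdVec a) = _
    rw [fderiv_clm_apply hd (by fun_prop)]
    simp
  rw [key, key]
  exact hs _ _

/-! ### Smooth metrics -/

/-- `γ` is a smooth (pseudo-Riemannian) metric on the open set `U`. -/
structure IsMetricOn (U : Set (Coord d)) (γ : MetricField d) : Prop where
  isOpen : IsOpen U
  smooth : ∀ a b, ContDiffOn ℝ ∞ (fun z => γ z a b) U
  symm : ∀ z ∈ U, ∀ a b, γ z a b = γ z b a
  isUnit_det : ∀ z ∈ U, IsUnit (γ z).det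

lemma smoothOn_det {A : Coord d → Matrix (Fin d) (Fin d) ℝ}
    (h : ∀ a b, ContDiffOn ℝ ∞ (fun z => A z a b) U) : ContDiffOn ℝ ∞ (fun z => (A z).det) U := by
  simp only [Matrix.det_apply]
  refine ContDiffOn.sum fun p _ => ?_
  simp only [Units.smul_def, zsmul_eq_mul]
  exact contDiffOn_const.mul (contDiffOn_prod fun i _ => h _ _)

namespace IsMetricOn

variable {γ : MetricField d} (hγ : IsMetricOn U γ)
include hγ

lemma smooth_inv (a b : Fin d) : ContDiffOn ℝ ∞ (fun z => (γ z)⁻¹ a b) U := by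
  -- Cramer's rule: the adjugate entry is itself a determinant, so smoothness reduces to that of
  -- determinants and of the reciprocal of a nonvanishing one.
  have h : ∀ z, (γ z)⁻¹ a b = ((γ z).det)⁻¹ * ((γ z).updateRow b (Pi.single a 1)).det := by
    intro z
    simp [Matrix.inv_def, Matrix.adjugate_apply, Ring.inverse_eq_inv']
  simp only [h]
  refine ((smoothOn_det hγ.smooth).inv fun z hz => (hγ.isUnit_det z hz).ne_zero).mul
    (smoothOn_det fun i j => ?_)
  by_cases hi : i = b
  · subst hi; simpa using contDiffOn_const
  · simpa [Matrix.updateRow_ne hi] using hγ.smooth i j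

lemma inv_symm (hy : y ∈ U) (a b : Fin d) : (γ y)⁻¹ a b = (γ y)⁻¹ b a := by
  have h : (γ y).transpose = γ y := by
    ext i j; exact hγ.symm y hy j i
  calc (γ y)⁻¹ a b = ((γ y).transpose)⁻¹ a b := by rw [h]
    _ = _ := by rw [← Matrix.transpose_nonsing_inv]; rfl

lemma sum_inv_mul (hy : y ∈ U) (a b : Fin d) :
    ∑ e, (γ y)⁻¹ a e * γ y e b = if a = b then 1 else 0 := by
  rw [← Matrix.mul_apply, Matrix.nonsing_inv_mul _ (hγ.isUnit_det y hy), Matrix.one_apply]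

lemma sum_mul_inv (hy : y ∈ U) (a b : Fin d) :
    ∑ e, γ y a e * (γ y)⁻¹ e b = if a = b then 1 else 0 := by
  rw [← Matrix.mul_apply, Matrix.mul_nonsing_inv _ (hγ.isUnit_det y hy), Matrix.one_apply]

lemma diffAt (hy : y ∈ U) (a b : Fin d) : DifferentiableAt ℝ (fun z => γ z a b) y :=
  differentiableAt_of_smoothOn hγ.isOpen (hγ.smooth a b) hy

lemma diffAt_inv (hy : y ∈ U) (a b : Fin d) : DifferentiableAt ℝ (fun z => (γ z)⁻¹ a b) y :=
  differentiableAt_of_smoothOn hγ.isOpen (hγ.smooth_inv a b) hy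

lemma pd_symm (hy : y ∈ U) (e a b : Fin d) :
    pd e (fun z => γ z a b) y = pd e (fun z => γ z b a) y :=
  pd_congr hγ.isOpen (fun z hz => hγ.symm z hz a b) e hy

lemma smooth_christoffel (c a b : Fin d) : ContDiffOn ℝ ∞ (christoffel γ c a b) U := by
  unfold christoffel
  refine contDiffOn_const.mul (ContDiffOn.sum fun e _ => (hγ.smooth_inv c e).mul ?_)
  exact ((smoothOn_pd hγ.isOpen (hγ.smooth _ _) _).add
    (smoothOn_pd hγ.isOpen (hγ.smooth _ _) _)).sub (smoothOn_pd hγ.isOpen (hγ.smooth _ _) _)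

lemma diffAt_christoffel (hy : y ∈ U) (c a b : Fin d) :
    DifferentiableAt ℝ (christoffel γ c a b) y :=
  differentiableAt_of_smoothOn hγ.isOpen (hγ.smooth_christoffel c a b) hy

lemma christoffel_symm (hy : y ∈ U) (c a b : Fin d) :
    christoffel γ c a b y = christoffel γ c b a y := by
  unfold christoffel
  congr 1
  refine Finset.sum_congr rfl fun e _ => ?_
  rw [hγ.pd_symm hy e a b]; ring

/-- Lowering the index cancels the inverse metric and leaves the symbols of the first kind, which
are linear in the derivatives of the metric. -/
lemma lower_christoffel (hy : y ∈ U) (e a b : Fin d) :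
    ∑ c, γ y e c * christoffel γ c a b y =
      (1 / 2) * (pd a (fun z => γ z b e) y + pd b (fun z => γ z a e) y
        - pd e (fun z => γ z a b) y) := by
  set X : Fin d → ℝ := fun e => pd a (fun z => γ z b e) y + pd b (fun z => γ z a e) y
        - pd e (fun z => γ z a b) y with hX
  have h : ∀ c, γ y e c * christoffel γ c a b y
      = ∑ i, (1 / 2) * ((γ y e c * (γ y)⁻¹ c i) * X i) := by
    intro c
    simp only [christoffel, Finset.mul_sum, hX]
    refine Finset.sum_congr rfl fun i _ => ?_
    ring
  simp only [h]
  rw [Finset.sum_comm]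
  simp only [← Finset.mul_sum, ← Finset.sum_mul, hγ.sum_mul_inv hy]
  simp [hX]

/-- Metric compatibility $\nabla\gamma=0$: in the sum of the two first-kind symbols all derivatives
but one cancel. -/
lemma pd_metric (hy : y ∈ U) (a b c : Fin d) :
    pd a (fun z => γ z b c) y = ∑ e, γ y c e * christoffel γ e a b y
      + ∑ e, γ y b e * christoffel γ e a c y := by
  rw [hγ.lower_christoffel hy, hγ.lower_christoffel hy, hγ.pd_symm hy a c b,
    hγ.pd_symm hy c a b, hγ.pd_symm hy b a c]
  rw [hγ.pd_symm hy c b a]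
  ring

/-- This is $\nabla\gamma^{-1}=0$. Differentiating $\gamma^{-1}\gamma=1$ gives
$\partial\gamma^{-1}=-\gamma^{-1}(\partial\gamma)\gamma^{-1}$, and $\partial\gamma$ is known from
metric compatibility. -/
lemma pd_inv (hy : y ∈ U) (a b c : Fin d) :
    pd a (fun z => (γ z)⁻¹ b c) y = - ∑ e, (γ y)⁻¹ e c * christoffel γ b a e y
      - ∑ e, (γ y)⁻¹ b e * christoffel γ c a e y := by
  let A : Matrix (Fin d) (Fin d) ℝ := (γ y)⁻¹
  let DA : Matrix (Fin d) (Fin d) ℝ := Matrix.of fun i j => pd a (fun z => (γ z)⁻¹ i j) y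
  let DG : Matrix (Fin d) (Fin d) ℝ := Matrix.of fun i j => pd a (fun z => γ z i j) y
  let C : Matrix (Fin d) (Fin d) ℝ := Matrix.of fun i j => christoffel γ i a j y
  have hDG : DG = (γ y * C).transpose + γ y * C := by
    ext i j
    simp only [DG, C, Matrix.of_apply, Matrix.add_apply, Matrix.transpose_apply, Matrix.mul_apply]
    exact hγ.pd_metric hy a i j
  have hGT : (γ y).transpose = γ y := by ext i j; exact hγ.symm y hy j i
  have h0 : DA * γ y + A * DG = 0 := by
    ext i j
    simp only [DA, DG, A, Matrix.add_apply, Matrix.mul_apply, Matrix.of_apply, Matrix.zero_apply]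
    rw [← Finset.sum_add_distrib]
    have := pd_congr hγ.isOpen (fun z hz => hγ.sum_inv_mul hz i j) a hy
    rw [pd_const, pd_sum_mul _ (hγ.diffAt_inv hy i) (fun e => hγ.diffAt hy e j)] at this
    exact this
  have hu := hγ.isUnit_det y hy
  have h1 : DA = - (C * A) - A * C.transpose := by
    have h2 : DA = - (A * DG * A) := by
      have : DA * γ y * A = DA := by
        rw [Matrix.mul_assoc, Matrix.mul_nonsing_inv _ hu, Matrix.mul_one]
      rw [← this, eq_neg_of_add_eq_zero_left h0, Matrix.neg_mul]
    rw [h2, hDG, Matrix.transpose_mul, hGT]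
    rw [Matrix.mul_add, Matrix.add_mul, neg_add]
    have e1 : A * (γ y * C) * A = C * A := by
      rw [← Matrix.mul_assoc A, Matrix.nonsing_inv_mul _ hu, Matrix.one_mul]
    have e2 : A * (C.transpose * γ y) * A = A * C.transpose := by
      rw [Matrix.mul_assoc, Matrix.mul_assoc C.transpose, Matrix.mul_nonsing_inv _ hu,
        Matrix.mul_one]
    rw [e1, e2]; abel
  have := congrFun (congrFun h1 b) c
  simp only [DA, A, C, Matrix.of_apply, Matrix.sub_apply, Matrix.neg_apply, Matrix.mul_apply,
    Matrix.transpose_apply] at this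
  rw [this]
  congr 2
  exact Finset.sum_congr rfl fun e _ => mul_comm _ _

end IsMetricOn

/-- The covariant derivative `∇_a v_b` of a covector field. -/
def covDeriv (γ : MetricField d) (v : Fin d → Coord d → ℝ) (a b : Fin d) (y : Coord d) : ℝ :=
  pd a (v b) y - ∑ f, christoffel γ f a b y * v f y

/-- The vector field `v^c = γ^{ce} v_e`. -/
def raise (γ : MetricField d) (v : Fin d → Coord d → ℝ) (c : Fin d) (y : Coord d) : ℝ :=
  ∑ e, (γ y)⁻¹ c e * v e y

namespace IsMetricOn

variable {γ : MetricField d} (hγ : IsMetricOn U γ) {v : Fin d → Coord d → ℝ}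
include hγ

lemma smooth_raise (hv : ∀ a, ContDiffOn ℝ ∞ (v a) U) (c : Fin d) :
    ContDiffOn ℝ ∞ (raise γ v c) U :=
  ContDiffOn.sum fun e _ => (hγ.smooth_inv c e).mul (hv e)

lemma smooth_covDeriv (hv : ∀ a, ContDiffOn ℝ ∞ (v a) U) (a b : Fin d) :
    ContDiffOn ℝ ∞ (covDeriv γ v a b) U :=
  (smoothOn_pd hγ.isOpen (hv b) a).sub
    (ContDiffOn.sum fun f _ => (hγ.smooth_christoffel f a b).mul (hv f))

lemma sum_lower_raise (hy : y ∈ U) (a : Fin d) : ∑ b, γ y a b * raise γ v b y = v a y := by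
  simp only [raise, Finset.mul_sum, ← mul_assoc]
  rw [Finset.sum_comm]
  simp [← Finset.sum_mul, hγ.sum_mul_inv hy]

lemma sum_raise_lower (hy : y ∈ U) (a : Fin d) : ∑ b, raise γ v b y * γ y b a = v a y := by
  rw [← hγ.sum_lower_raise (v := v) hy a]
  exact Finset.sum_congr rfl fun b _ => by rw [hγ.symm y hy b a, mul_comm]

/-- Raising an index commutes with the Levi-Civita connection; the identity is
$\nabla_av^c=\gamma^{ce}\nabla_av_e$ with the partial derivative isolated. -/
lemma pd_raise (hv : ∀ a, ContDiffOn ℝ ∞ (v a) U) (hy : y ∈ U) (a c : Fin d) :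
    pd a (raise γ v c) y = - ∑ f, christoffel γ c a f y * raise γ v f y
      + ∑ e, (γ y)⁻¹ c e * covDeriv γ v a e y := by
  have hv' : ∀ a, DifferentiableAt ℝ (v a) y :=
    fun a => differentiableAt_of_smoothOn hγ.isOpen (hv a) hy
  unfold raise covDeriv
  rw [pd_sum_mul _ (hγ.diffAt_inv hy c) hv']
  simp only [hγ.pd_inv hy, Finset.sum_add_distrib,
    sub_mul, neg_mul, Finset.sum_sub_distrib, Finset.sum_neg_distrib, mul_sub, Finset.mul_sum,
    Finset.sum_mul]
  rw [Finset.sum_comm (f := fun i j => christoffel γ c a i y * ((γ y)⁻¹ i j * v j y)),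
    Finset.sum_comm (f := fun i j => (γ y)⁻¹ c i * (christoffel γ j a i y * v j y))]
  have e1 : ∀ i j, (γ y)⁻¹ j i * christoffel γ c a j y * v i y
      = christoffel γ c a j y * ((γ y)⁻¹ j i * v i y) := fun i j => by ring
  have e2 : ∀ i j, (γ y)⁻¹ c j * christoffel γ i a j y * v i y
      = (γ y)⁻¹ c j * (christoffel γ i a j y * v i y) := fun i j => by ring
  simp only [e1, e2]
  ring

end IsMetricOn

end TractorCalculus

namespace TractorCalculus

variable {d : ℕ} {U : Set (Coord d)} {y : Coord d}

/-! ### Conformal change of the metric -/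

/-- The difference `δ^c_a v_b + δ^c_b v_a - γ_{ab} t^c` of the Levi-Civita connections of
conformally related metrics, as an array of numbers. -/
def conformalDiff (g : Fin d → Fin d → ℝ) (v t : Fin d → ℝ) (c a b : Fin d) : ℝ :=
  (if c = a then v b else 0) + (if c = b then v a else 0) - g a b * t c

/-! ### Contractions of the difference tensor -/

section Arrays

variable {g : Fin d → Fin d → ℝ} {v t : Fin d → ℝ} (hg : ∀ a b, g a b = g b a)
  (hv : ∀ a, ∑ c, g a c * t c = v a)
include hg hv

/-- Under a conformal change $\Gamma$ becomes $\Gamma+C$, so the quadratic part of Ricci acquires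
terms $\Gamma C$, $C\Gamma$ and $CC$. This lemma and the following ones evaluate these contractions
pointwise for arbitrary arrays; `hv` says that $t$ is $v$ with its index raised. -/
lemma sum_conformalDiff_self (b : Fin d) : ∑ c, conformalDiff g v t c c b = d * v b := by
  have h : ∑ c, g c b * t c = v b := by
    rw [← hv b]; exact Finset.sum_congr rfl fun c _ => by rw [hg]
  simp [conformalDiff, Finset.sum_add_distrib, Finset.sum_sub_distrib, h]

lemma sum_conformalDiff_mul (G : Fin d → Fin d → Fin d → ℝ) (a b : Fin d) :
    ∑ c, ∑ f, conformalDiff g v t c c f * G f a b = d * ∑ f, v f * G f a b := by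
  rw [Finset.sum_comm]
  simp only [← Finset.sum_mul, sum_conformalDiff_self hg hv, Finset.mul_sum, mul_assoc]

omit hg hv in
lemma sum_mul_conformalDiff (G : Fin d → Fin d → Fin d → ℝ) (a b : Fin d) :
    ∑ c, ∑ f, G c c f * conformalDiff g v t f a b
      = (∑ c, G c c a) * v b + (∑ c, G c c b) * v a - g a b * ∑ c, ∑ f, G c c f * t f := by
  simp only [conformalDiff, mul_add, mul_sub, mul_ite, mul_zero, Finset.sum_add_distrib,
    Finset.sum_sub_distrib, Finset.sum_ite_eq', Finset.mem_univ, if_true, Finset.sum_mul,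
    Finset.mul_sum]
  congr 1
  exact Finset.sum_congr rfl fun c _ => Finset.sum_congr rfl fun f _ => by ring

omit hg hv in
lemma sum_covector_mul_conformalDiff (w : Fin d → ℝ) (a b : Fin d) :
    ∑ f, w f * conformalDiff g v t f a b
      = w a * v b + w b * v a - g a b * ∑ f, w f * t f := by
  simp only [conformalDiff, mul_add, mul_sub, mul_ite, mul_zero, Finset.sum_add_distrib,
    Finset.sum_sub_distrib, Finset.sum_ite_eq', Finset.mem_univ, if_true, Finset.mul_sum]
  congr 1
  exact Finset.sum_congr rfl fun f _ => by ring

lemma sum_conformalDiff_mul_self (a b : Fin d) :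
    ∑ c, ∑ f, conformalDiff g v t c c f * conformalDiff g v t f a b
      = d * (2 * v a * v b - g a b * ∑ f, v f * t f) := by
  rw [sum_conformalDiff_mul hg hv (conformalDiff g v t)]
  rw [sum_covector_mul_conformalDiff]
  ring

omit hg hv in
lemma sum_mul_conformalDiff_cross (G : Fin d → Fin d → Fin d → ℝ) (a b : Fin d) :
    ∑ c, ∑ f, G c a f * conformalDiff g v t f c b
      = (∑ c, G c a c) * v b + ∑ c, G c a b * v c - ∑ c, ∑ f, G c a f * (g c b * t f) := by
  simp only [conformalDiff, mul_add, mul_sub, mul_ite, mul_zero, Finset.sum_add_distrib,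
    Finset.sum_sub_distrib, Finset.sum_ite_eq', Finset.mem_univ, if_true, Finset.sum_mul]

omit hg hv in
lemma sum_conformalDiff_cross_mul (G : Fin d → Fin d → Fin d → ℝ) (a b : Fin d) :
    ∑ c, ∑ f, conformalDiff g v t c a f * G f c b
      = ∑ f, v f * G f a b + v a * (∑ c, G c c b) - ∑ c, ∑ f, g a f * t c * G f c b := by
  simp only [conformalDiff, add_mul, sub_mul, ite_mul, zero_mul, Finset.sum_add_distrib,
    Finset.sum_sub_distrib, Finset.sum_ite_eq, Finset.mem_univ, if_true, Finset.mul_sum]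
  rw [Finset.sum_comm]
  simp

lemma sum_conformalDiff_cross_self (a b : Fin d) :
    ∑ c, ∑ f, conformalDiff g v t c a f * conformalDiff g v t f c b
      = (d + 2) * v a * v b - 2 * g a b * ∑ f, v f * t f := by
  rw [sum_conformalDiff_cross_mul (conformalDiff g v t), sum_conformalDiff_self hg hv]
  have h2 : ∑ c, ∑ f, g a f * t c * conformalDiff g v t f c b = g a b * ∑ f, v f * t f := by
    have hb : ∑ c, t c * g c b = v b := by
      rw [← hv b]; exact Finset.sum_congr rfl fun c _ => by rw [hg, mul_comm]
    have h3 : ∀ c f, g a f * t c * conformalDiff g v t f c b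
        = t c * (g a f * conformalDiff g v t f c b) := fun c f => by ring
    simp only [h3, ← Finset.mul_sum, sum_covector_mul_conformalDiff, hv]
    have h4 : ∀ c, t c * (g a c * v b + g a b * v c - g c b * v a)
        = g a c * t c * v b + g a b * (v c * t c) - t c * g c b * v a := fun c => by ring
    simp only [h4, Finset.sum_add_distrib, Finset.sum_sub_distrib, ← Finset.sum_mul,
      ← Finset.mul_sum, hv, hb]
    ring
  rw [sum_covector_mul_conformalDiff, h2]; ring

end Arrays

/-- The metric `σ⁻² γ`. -/
def conformalMetric (σ : Coord d → ℝ) (γ : MetricField d) : MetricField d :=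
  fun z => (σ z ^ 2)⁻¹ • γ z

/-- The covector `- ∂_a log σ`. -/
def negLogDeriv (σ : Coord d → ℝ) (a : Fin d) (z : Coord d) : ℝ := - (σ z)⁻¹ * pd a σ z

namespace IsMetricOn

variable {γ : MetricField d} (hγ : IsMetricOn U γ) {σ : Coord d → ℝ}
  (hσ : ContDiffOn ℝ ∞ σ U) (hσ0 : ∀ z ∈ U, 0 < σ z)
include hγ hσ hσ0

lemma conformal : IsMetricOn U (conformalMetric σ γ) where
  isOpen := hγ.isOpen
  smooth a b := by
    refine ContDiffOn.mul ((hσ.pow 2).inv fun z hz => ?_) (hγ.smooth a b)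
    exact pow_ne_zero _ (hσ0 z hz).ne'
  symm z hz a b := by simp [conformalMetric, hγ.symm z hz a b]
  isUnit_det z hz := by
    have := hσ0 z hz
    simp only [conformalMetric, Matrix.det_smul]
    exact (IsUnit.mk0 _ (by positivity)).mul (hγ.isUnit_det z hz)

omit hσ in
lemma inv_conformalMetric (hy : y ∈ U) (a b : Fin d) :
    (conformalMetric σ γ y)⁻¹ a b = σ y ^ 2 * (γ y)⁻¹ a b := by
  have := hσ0 y hy
  have hne : (σ y ^ 2)⁻¹ ≠ 0 := by positivity
  have h := Matrix.inv_smul' (A := γ y) (Units.mk0 _ hne) (hγ.isUnit_det y hy)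
  have h' : (conformalMetric σ γ y)⁻¹ = (σ y ^ 2) • (γ y)⁻¹ := by
    have e : conformalMetric σ γ y = (Units.mk0 _ hne) • γ y := rfl
    rw [e, h]
    simp [Units.smul_def]
  rw [h']; rfl

lemma smooth_negLogDeriv (a : Fin d) : ContDiffOn ℝ ∞ (negLogDeriv σ a) U :=
  ((hσ.inv fun z hz => (hσ0 z hz).ne').neg).mul (smoothOn_pd hγ.isOpen hσ a)

lemma pd_conformalMetric (hy : y ∈ U) (e a b : Fin d) :
    pd e (fun z => conformalMetric σ γ z a b) y = (σ y ^ 2)⁻¹ *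
      (pd e (fun z => γ z a b) y + 2 * negLogDeriv σ e y * γ y a b) := by
  have h0 := (hσ0 y hy).ne'
  have hs := differentiableAt_of_smoothOn hγ.isOpen hσ hy
  have hd : HasDerivAt (fun t : ℝ => (t ^ 2)⁻¹) (- (2 * σ y) / (σ y ^ 2) ^ 2) (σ y) := by
    simpa using (hasDerivAt_pow 2 (σ y)).fun_inv (pow_ne_zero 2 h0)
  have := pd_comp hd hs e
  simp only [conformalMetric, Matrix.smul_apply, smul_eq_mul]
  rw [pd_mul _ (hγ.diffAt hy a b), this]
  · unfold negLogDeriv; field_simp; ring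
  · exact hd.differentiableAt.comp y hs

/-- Here $\sigma^{-2}\gamma=e^{2\omega}\gamma$ with $\omega=-\log\sigma$. The extra terms come from
differentiating the conformal factor, whose logarithmic derivative is $2\,d\omega$. -/
lemma christoffel_conformalMetric (hy : y ∈ U) (c a b : Fin d) :
    christoffel (conformalMetric σ γ) c a b y = christoffel γ c a b y
      + conformalDiff (γ y) (fun e => negLogDeriv σ e y)
          (fun e => raise γ (negLogDeriv σ) e y) c a b := by
  have h0 := (hσ0 y hy).ne'
  unfold christoffel
  simp only [hγ.inv_conformalMetric hσ0 hy, hγ.pd_conformalMetric hσ hσ0 hy]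
  have h1 : ∀ e, σ y ^ 2 * (γ y)⁻¹ c e *
      ((σ y ^ 2)⁻¹ * (pd a (fun z => γ z b e) y + 2 * negLogDeriv σ a y * γ y b e)
        + (σ y ^ 2)⁻¹ * (pd b (fun z => γ z a e) y + 2 * negLogDeriv σ b y * γ y a e)
        - (σ y ^ 2)⁻¹ * (pd e (fun z => γ z a b) y + 2 * negLogDeriv σ e y * γ y a b))
      = (γ y)⁻¹ c e * (pd a (fun z => γ z b e) y + pd b (fun z => γ z a e) y
          - pd e (fun z => γ z a b) y)
        + 2 * ((γ y)⁻¹ c e * γ y e b * negLogDeriv σ a y + (γ y)⁻¹ c e * γ y e a * negLogDeriv σ b y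
          - γ y a b * ((γ y)⁻¹ c e * negLogDeriv σ e y)) := by
    intro e
    rw [hγ.symm y hy b e, hγ.symm y hy a e]
    field_simp
    ring
  simp only [h1, Finset.sum_add_distrib, ← Finset.mul_sum, Finset.sum_sub_distrib, ← Finset.sum_mul,
    hγ.sum_inv_mul hy, conformalDiff, raise]
  simp only [ite_mul, one_mul, zero_mul]
  ring

lemma pd_negLogDeriv (hy : y ∈ U) (a b : Fin d) :
    pd a (negLogDeriv σ b) y = - (σ y)⁻¹ * pd a (pd b σ) y
      + negLogDeriv σ a y * negLogDeriv σ b y := by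
  have h0 := (hσ0 y hy).ne'
  have hs := differentiableAt_of_smoothOn hγ.isOpen hσ hy
  have hd : HasDerivAt (fun t : ℝ => - t⁻¹) (σ y ^ 2)⁻¹ (σ y) := by
    simpa using (hasDerivAt_inv h0).fun_neg
  have hp := differentiableAt_of_smoothOn hγ.isOpen (smoothOn_pd hγ.isOpen hσ b) hy
  have := pd_comp hd hs a
  unfold negLogDeriv
  have hd' : DifferentiableAt ℝ (fun z => - (σ z)⁻¹) y := hd.differentiableAt.comp y hs
  rw [pd_mul hd' hp, this]
  field_simp
  ring

lemma pd_christoffel_conformalMetric (hy : y ∈ U) (e c a b : Fin d) :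
    pd e (christoffel (conformalMetric σ γ) c a b) y = pd e (christoffel γ c a b) y
      + (if c = a then pd e (negLogDeriv σ b) y else 0)
      + (if c = b then pd e (negLogDeriv σ a) y else 0)
      - (pd e (fun z => γ z a b) y * raise γ (negLogDeriv σ) c y
        + γ y a b * pd e (raise γ (negLogDeriv σ) c) y) := by
  have hv := fun a => hγ.smooth_negLogDeriv hσ hσ0 a
  have hv' := fun a => differentiableAt_of_smoothOn hγ.isOpen (hv a) hy
  have ht' := differentiableAt_of_smoothOn hγ.isOpen (hγ.smooth_raise hv c) hy
  have hif : ∀ (p : Prop) [Decidable p] (a : Fin d),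
      DifferentiableAt ℝ (fun z => if p then negLogDeriv σ a z else 0) y := by
    intro p _ a
    split_ifs
    · exact hv' a
    · exact differentiableAt_const _
  have hpif : ∀ (p : Prop) [Decidable p] (a : Fin d),
      pd e (fun z => if p then negLogDeriv σ a z else 0) y
        = if p then pd e (negLogDeriv σ a) y else 0 := by
    intro p _ a
    split_ifs
    · rfl
    · simp
  rw [pd_congr hγ.isOpen (fun z hz => hγ.christoffel_conformalMetric hσ hσ0 hz c a b) e hy]
  unfold conformalDiff
  have hg' := (hγ.diffAt hy a b).fun_mul ht'
  rw [pd_add (hγ.diffAt_christoffel hy c a b) (((hif _ _).fun_add (hif _ _)).fun_sub hg'),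
    pd_sub ((hif _ _).fun_add (hif _ _)) hg', pd_add (hif _ _) (hif _ _),
    pd_mul (hγ.diffAt hy a b) ht', hpif, hpif]
  ring

omit hσ hσ0 in
/-- The divergence of `v^a`. -/
lemma sum_inv_covDeriv {v : Fin d → Coord d → ℝ} (hv : ∀ a, ContDiffOn ℝ ∞ (v a) U)
    (hy : y ∈ U) : ∑ a, ∑ b, (γ y)⁻¹ a b * covDeriv γ v a b y
      = ∑ c, pd c (raise γ v c) y + ∑ c, ∑ f, christoffel γ c c f y * raise γ v f y := by
  simp only [hγ.pd_raise hv hy, Finset.sum_add_distrib, Finset.sum_neg_distrib]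
  ring

omit hγ hσ hσ0 in
lemma _root_.TractorCalculus.ricci_eq (γ : MetricField d) (a b : Fin d) (y : Coord d) : ricci γ a b y
    = ∑ c, pd c (christoffel γ c a b) y - ∑ c, pd a (christoffel γ c c b) y
      + (∑ c, ∑ f, christoffel γ c c f y * christoffel γ f a b y
        - ∑ c, ∑ f, christoffel γ c a f y * christoffel γ f c b y) := by
  simp only [ricci, riemann, Finset.sum_add_distrib, Finset.sum_sub_distrib]

/-- The classical formula with $\upsilon=-d\log\sigma$. Derivatives of $C$ and the mixed products
with $\Gamma$ assemble into $\nabla\upsilon$ and its trace; the products $CC$ give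
$\upsilon\otimes\upsilon$ and $|\upsilon|^2$. -/
lemma ricci_conformalMetric (hy : y ∈ U) (a b : Fin d) :
    ricci (conformalMetric σ γ) a b y = ricci γ a b y
      - (d - 2) * (covDeriv γ (negLogDeriv σ) a b y - negLogDeriv σ a y * negLogDeriv σ b y)
      - γ y a b * (∑ a, ∑ b, (γ y)⁻¹ a b * covDeriv γ (negLogDeriv σ) a b y
        + (d - 2) * ∑ f, negLogDeriv σ f y * raise γ (negLogDeriv σ) f y) := by
  have hv := fun a => hγ.smooth_negLogDeriv hσ hσ0 a
  -- The form $d\log\sigma$ is closed.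
  have hsymm : pd b (negLogDeriv σ a) y = pd a (negLogDeriv σ b) y := by
    rw [hγ.pd_negLogDeriv hσ hσ0 hy, hγ.pd_negLogDeriv hσ hσ0 hy, pd_comm hγ.isOpen hσ hy]
    ring
  have hlow : ∀ a, ∑ c, γ y a c * raise γ (negLogDeriv σ) c y = negLogDeriv σ a y :=
    hγ.sum_lower_raise hy
  have hdlow : ∑ c, (pd a (fun z => γ z c b) y * raise γ (negLogDeriv σ) c y
      + γ y c b * pd a (raise γ (negLogDeriv σ) c) y) = pd a (negLogDeriv σ b) y := by
    rw [← pd_congr hγ.isOpen (fun z hz => hγ.sum_lower_raise (v := negLogDeriv σ) hz b) a hy,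
      pd_sum_mul _ (fun e => hγ.diffAt hy b e) (fun e => differentiableAt_of_smoothOn hγ.isOpen
        (hγ.smooth_raise hv e) hy)]
    refine Finset.sum_congr rfl fun e _ => ?_
    rw [hγ.symm y hy b e, hγ.pd_symm hy a b e]
  -- Differentiating the term $\gamma_{ab}t^c$ of $C$ produces $\partial\gamma$. Written through
  -- $\Gamma$, it cancels against the mixed products with $\Gamma$.
  have hcompat : ∑ c, pd c (fun z => γ z a b) y * raise γ (negLogDeriv σ) c y
      = ∑ c, ∑ f, γ y a f * raise γ (negLogDeriv σ) c y * christoffel γ f c b y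
        + ∑ c, ∑ f, christoffel γ c a f y * (γ y c b * raise γ (negLogDeriv σ) f y) := by
    rw [Finset.sum_comm (f := fun c f => christoffel γ c a f y * _), ← Finset.sum_add_distrib]
    refine Finset.sum_congr rfl fun c _ => ?_
    rw [hγ.pd_metric hy, add_mul, Finset.sum_mul, Finset.sum_mul, add_comm]
    congr 1
    · exact Finset.sum_congr rfl fun f _ => by ring
    · exact Finset.sum_congr rfl fun f _ => by
        rw [hγ.symm y hy b f, hγ.christoffel_symm hy f c a]; ring
  have hΓ : ∑ c, christoffel γ c c a y = ∑ c, christoffel γ c a c y :=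
    Finset.sum_congr rfl fun c _ => hγ.christoffel_symm hy _ _ _
  have hcomm : ∑ c, negLogDeriv σ c y * christoffel γ c a b y
      = ∑ c, christoffel γ c a b y * negLogDeriv σ c y :=
    Finset.sum_congr rfl fun c _ => mul_comm _ _
  have h1 : ∑ c, pd c (christoffel (conformalMetric σ γ) c a b) y
      = ∑ c, pd c (christoffel γ c a b) y + pd a (negLogDeriv σ b) y + pd b (negLogDeriv σ a) y
        - (∑ c, pd c (fun z => γ z a b) y * raise γ (negLogDeriv σ) c y
          + γ y a b * ∑ c, pd c (raise γ (negLogDeriv σ) c) y) := by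
    simp only [hγ.pd_christoffel_conformalMetric hσ hσ0 hy, Finset.sum_add_distrib,
      Finset.sum_sub_distrib, Finset.sum_ite_eq', Finset.mem_univ, if_true, Finset.mul_sum]
  have h2 : ∑ c, pd a (christoffel (conformalMetric σ γ) c c b) y
      = ∑ c, pd a (christoffel γ c c b) y + d * pd a (negLogDeriv σ b) y := by
    simp only [hγ.pd_christoffel_conformalMetric hσ hσ0 hy, Finset.sum_add_distrib,
      Finset.sum_sub_distrib, Finset.sum_ite_eq', Finset.mem_univ, if_true] at hdlow ⊢
    rw [hdlow]
    simp
  rw [ricci_eq, ricci_eq γ, h1, h2, hsymm, hcompat, hγ.sum_inv_covDeriv hv hy]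
  simp only [hγ.christoffel_conformalMetric hσ hσ0 hy, add_mul, mul_add, Finset.sum_add_distrib]
  have hg := hγ.symm y hy
  rw [sum_conformalDiff_mul hg hlow (fun c a b => christoffel γ c a b y),
    sum_mul_conformalDiff (g := γ y) (v := fun e => negLogDeriv σ e y)
      (t := fun e => raise γ (negLogDeriv σ) e y) (fun c a b => christoffel γ c a b y),
    sum_conformalDiff_mul_self hg hlow,
    sum_mul_conformalDiff_cross (g := γ y) (v := fun e => negLogDeriv σ e y)
      (t := fun e => raise γ (negLogDeriv σ) e y) (fun c a b => christoffel γ c a b y),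
    sum_conformalDiff_cross_mul (g := γ y) (v := fun e => negLogDeriv σ e y)
      (t := fun e => raise γ (negLogDeriv σ) e y) (fun c a b => christoffel γ c a b y),
    sum_conformalDiff_cross_self hg hlow, hcomm, hΓ, covDeriv]
  ring

end IsMetricOn

end TractorCalculus

namespace TractorCalculus

variable {d : ℕ} {U : Set (Coord d)} {y : Coord d}

/-! ### Conformally Einstein metrics -/

/-- The differential of a function, as a covector field. -/
def grad (f : Coord d → ℝ) (a : Fin d) : Coord d → ℝ := pd a f

/-- The pairing `⟨df, dh⟩` with respect to `γ`. -/
def gradInner (γ : MetricField d) (f h : Coord d → ℝ) (y : Coord d) : ℝ :=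
  ∑ a, raise γ (grad f) a y * pd a h y

/-- The function `(1 - |dσ|²) / (2σ)`. -/
def scaleBot (γ : MetricField d) (σ : Coord d → ℝ) (y : Coord d) : ℝ :=
  (1 - gradInner γ σ σ y) * (2 * σ y)⁻¹

lemma laplaceBeltrami_eq (γ : MetricField d) (f : Coord d → ℝ) (y : Coord d) :
    laplaceBeltrami γ f y = - ∑ a, ∑ b, (γ y)⁻¹ a b * covDeriv γ (grad f) a b y := rfl

/-- `σ⁻² γ` is an Einstein metric with `Ric = - (d - 1) σ⁻² γ` on `U`. -/
structure IsEinsteinScale (U : Set (Coord d)) (γ : MetricField d) (σ : Coord d → ℝ) : Prop where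
  metric : IsMetricOn U γ
  smooth : ContDiffOn ℝ ∞ σ U
  pos : ∀ z ∈ U, 0 < σ z
  ricci_eq : ∀ z ∈ U, ∀ a b, ricci (conformalMetric σ γ) a b z
    = - ((d : ℝ) - 1) * conformalMetric σ γ z a b

lemma raise_negLogDeriv (γ : MetricField d) (σ : Coord d → ℝ) (a : Fin d) (y : Coord d) :
    raise γ (negLogDeriv σ) a y = - (σ y)⁻¹ * raise γ (grad σ) a y := by
  simp only [raise, negLogDeriv, grad, Finset.mul_sum]
  exact Finset.sum_congr rfl fun e _ => by ring

lemma sum_negLogDeriv_raise (γ : MetricField d) (σ : Coord d → ℝ) (y : Coord d) :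
    ∑ f, negLogDeriv σ f y * raise γ (negLogDeriv σ) f y
      = (σ y)⁻¹ ^ 2 * gradInner γ σ σ y := by
  simp only [raise_negLogDeriv, gradInner, negLogDeriv, Finset.mul_sum]
  exact Finset.sum_congr rfl fun e _ => by ring

namespace IsMetricOn

variable {γ : MetricField d} (hγ : IsMetricOn U γ) {σ : Coord d → ℝ}
include hγ

lemma smooth_gradInner {f h : Coord d → ℝ} (hf : ContDiffOn ℝ ∞ f U) (hh : ContDiffOn ℝ ∞ h U) :
    ContDiffOn ℝ ∞ (gradInner γ f h) U :=
  ContDiffOn.sum fun a _ => (hγ.smooth_raise (fun b => smoothOn_pd hγ.isOpen hf b) a).mul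
    (smoothOn_pd hγ.isOpen hh a)

lemma smooth_laplaceBeltrami {f : Coord d → ℝ} (hf : ContDiffOn ℝ ∞ f U) :
    ContDiffOn ℝ ∞ (laplaceBeltrami γ f) U :=
  (ContDiffOn.sum fun a _ => ContDiffOn.sum fun b _ => (hγ.smooth_inv a b).mul
    (hγ.smooth_covDeriv (v := grad f) (fun c => smoothOn_pd hγ.isOpen hf c) a b)).neg

lemma gradInner_comm (f h : Coord d → ℝ) (hy : y ∈ U) :
    gradInner γ f h y = gradInner γ h f y := by
  simp only [gradInner, raise, grad, Finset.sum_mul]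
  rw [Finset.sum_comm]
  refine Finset.sum_congr rfl fun a _ => Finset.sum_congr rfl fun b _ => ?_
  rw [hγ.inv_symm hy b a]; ring

/-- By metric compatibility, $d|d\sigma|^2$ is twice the Hessian of $\sigma$ applied to its
gradient. -/
lemma pd_gradInner_self (hσ : ContDiffOn ℝ ∞ σ U) (hy : y ∈ U) (a : Fin d) :
    pd a (gradInner γ σ σ) y = 2 * ∑ c, covDeriv γ (grad σ) a c y * raise γ (grad σ) c y := by
  have hs : ∀ c, ContDiffOn ℝ ∞ (grad σ c) U := fun c => smoothOn_pd hγ.isOpen hσ c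
  have h := pd_sum_mul Finset.univ (f := raise γ (grad σ)) (g := grad σ)
    (fun e => differentiableAt_of_smoothOn hγ.isOpen (hγ.smooth_raise hs e) hy)
    (fun e => differentiableAt_of_smoothOn hγ.isOpen (hs e) hy) a
  refine h.trans ?_
  have h1 : ∑ i, (∑ e, (γ y)⁻¹ i e * covDeriv γ (grad σ) a e y) * grad σ i y
      = ∑ c, covDeriv γ (grad σ) a c y * raise γ (grad σ) c y := by
    simp only [raise, Finset.sum_mul, Finset.mul_sum]
    rw [Finset.sum_comm]
    refine Finset.sum_congr rfl fun c _ => Finset.sum_congr rfl fun e _ => ?_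
    rw [hγ.inv_symm hy c e]; ring
  have h2 : ∑ i, raise γ (grad σ) i y * pd a (grad σ i) y
      - ∑ i, (∑ f, christoffel γ i a f y * raise γ (grad σ) f y) * grad σ i y
      = ∑ c, covDeriv γ (grad σ) a c y * raise γ (grad σ) c y := by
    simp only [covDeriv, sub_mul, Finset.sum_sub_distrib, Finset.sum_mul]
    rw [Finset.sum_comm (f := fun i f => christoffel γ i a f y * raise γ (grad σ) f y * _)]
    congr 1
    · exact Finset.sum_congr rfl fun c _ => mul_comm _ _
    · exact Finset.sum_congr rfl fun c _ => Finset.sum_congr rfl fun e _ => by ring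
  simp only [hγ.pd_raise hs hy, add_mul, neg_mul, Finset.sum_add_distrib, Finset.sum_neg_distrib]
  linear_combination h1 + h2

end IsMetricOn

namespace IsEinsteinScale

variable {γ : MetricField d} {σ : Coord d → ℝ} (h : IsEinsteinScale U γ σ)
include h

lemma covDeriv_negLogDeriv (hy : y ∈ U) (a b : Fin d) :
    covDeriv γ (negLogDeriv σ) a b y = - (σ y)⁻¹ * covDeriv γ (grad σ) a b y
      + negLogDeriv σ a y * negLogDeriv σ b y := by
  unfold covDeriv
  rw [h.metric.pd_negLogDeriv h.smooth h.pos hy]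
  have : ∑ f, christoffel γ f a b y * negLogDeriv σ f y
      = - (σ y)⁻¹ * ∑ f, christoffel γ f a b y * grad σ f y := by
    simp only [negLogDeriv, grad, Finset.mul_sum]
    exact Finset.sum_congr rfl fun e _ => by ring
  rw [this]
  simp only [grad]
  ring

/-- The conformal change formula solved for the Ricci tensor of $\gamma$, with the Einstein equation
inserted on the other side. Only the Hessian of $\sigma$ and multiples of $\gamma$ survive. -/
lemma ricci_base (hy : y ∈ U) (a b : Fin d) :
    ricci γ a b y = - (d - 2) * (σ y)⁻¹ * covDeriv γ (grad σ) a b y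
      + γ y a b * ((σ y)⁻¹ * laplaceBeltrami γ σ y
        + (d - 1) * (σ y)⁻¹ ^ 2 * (gradInner γ σ σ y - 1)) := by
  have h1 := h.metric.ricci_conformalMetric h.smooth h.pos hy a b
  have h2 : ∑ a, ∑ b, (γ y)⁻¹ a b * covDeriv γ (negLogDeriv σ) a b y
      = (σ y)⁻¹ * laplaceBeltrami γ σ y + (σ y)⁻¹ ^ 2 * gradInner γ σ σ y := by
    rw [← sum_negLogDeriv_raise, laplaceBeltrami_eq]
    simp only [h.covDeriv_negLogDeriv hy, mul_add, Finset.sum_add_distrib, mul_neg, raise,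
      Finset.mul_sum, ← Finset.sum_neg_distrib]
    congr 1 <;> refine Finset.sum_congr rfl fun a _ => Finset.sum_congr rfl fun b _ => ?_ <;> ring
  rw [h.ricci_eq y hy, h2, sum_negLogDeriv_raise, h.covDeriv_negLogDeriv hy] at h1
  simp only [conformalMetric, Matrix.smul_apply, smul_eq_mul, ← inv_pow] at h1
  linear_combination -h1

lemma schoutenTrace_eq (hd : (d : ℝ) ≠ 1) (hy : y ∈ U) :
    schoutenTrace γ y = (σ y)⁻¹ * laplaceBeltrami γ σ y
      + d / 2 * (σ y)⁻¹ ^ 2 * (gradInner γ σ σ y - 1) := by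
  have hd' : (d : ℝ) - 1 ≠ 0 := sub_ne_zero.2 hd
  have h1 : ∑ a, ∑ b, (γ y)⁻¹ a b * γ y a b = d := by
    have e : ∀ a, ∑ b, (γ y)⁻¹ a b * γ y a b = 1 := fun a => by
      rw [← if_pos (c := a = a) (t := (1 : ℝ)) (e := 0) rfl, ← h.metric.sum_inv_mul hy]
      exact Finset.sum_congr rfl fun b _ => by rw [h.metric.symm y hy a b]
    simp [e]
  have h2 : scalarCurvature γ y = (d - 2) * (σ y)⁻¹ * laplaceBeltrami γ σ y
      + d * ((σ y)⁻¹ * laplaceBeltrami γ σ y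
        + (d - 1) * (σ y)⁻¹ ^ 2 * (gradInner γ σ σ y - 1)) := by
    unfold scalarCurvature
    have e : ∀ a b, (γ y)⁻¹ a b * ricci γ a b y
        = - (d - 2) * (σ y)⁻¹ * ((γ y)⁻¹ a b * covDeriv γ (grad σ) a b y)
          + (γ y)⁻¹ a b * γ y a b * ((σ y)⁻¹ * laplaceBeltrami γ σ y
            + (d - 1) * (σ y)⁻¹ ^ 2 * (gradInner γ σ σ y - 1)) := fun a b => by
      rw [h.ricci_base hy]; ring
    simp only [e, Finset.sum_add_distrib, ← Finset.sum_mul, ← Finset.mul_sum, h1]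
    rw [laplaceBeltrami_eq]
    ring
  rw [schoutenTrace, h2]
  field_simp
  ring

/-- The middle slot of $\nabla I=0$. The value of the Einstein constant makes the pure trace part
exactly the bottom slot $\rho$ of $I$. -/
lemma schouten_eq (hd : (d : ℝ) ≠ 1) (hd2 : (d : ℝ) ≠ 2) (hy : y ∈ U) (a b : Fin d) :
    schouten γ a b y = - (σ y)⁻¹ * (covDeriv γ (grad σ) a b y + scaleBot γ σ y * γ y a b) := by
  have hd' : (d : ℝ) - 2 ≠ 0 := sub_ne_zero.2 hd2
  have h0 := (h.pos y hy).ne'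
  rw [schouten, h.ricci_base hy, h.schoutenTrace_eq hd hy, scaleBot]
  field_simp
  ring

lemma smooth_scaleBot : ContDiffOn ℝ ∞ (scaleBot γ σ) U :=
  (contDiffOn_const.sub (h.metric.smooth_gradInner h.smooth h.smooth)).mul
    ((contDiffOn_const.mul h.smooth).inv fun z hz => by have := h.pos z hz; positivity)

/-- The bottom slot of $\nabla I=0$. By definition $2\sigma\rho+|d\sigma|^2=1$, that is, $h(I,I)=1$.
Differentiating this and inserting the Schouten tensor from `schouten_eq` suffices, so no Bianchi
identity enters. -/
lemma pd_scaleBot (hd : (d : ℝ) ≠ 1) (hd2 : (d : ℝ) ≠ 2) (hy : y ∈ U) (a : Fin d) :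
    pd a (scaleBot γ σ) y = ∑ c, schouten γ a c y * raise γ (grad σ) c y := by
  have h0 := (h.pos y hy).ne'
  have hs := differentiableAt_of_smoothOn h.metric.isOpen h.smooth hy
  have hN := differentiableAt_of_smoothOn h.metric.isOpen
    (h.metric.smooth_gradInner h.smooth h.smooth) hy
  have hder : HasDerivAt (fun t : ℝ => (2 * t)⁻¹) (- 2 / (2 * σ y) ^ 2) (σ y) := by
    simpa using ((hasDerivAt_id (σ y)).const_mul 2).fun_inv (by simpa using h0)
  have h1 := pd_comp hder hs a
  have h2 : pd a (fun z => 1 - gradInner γ σ σ z) y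
      = - (2 * ∑ c, covDeriv γ (grad σ) a c y * raise γ (grad σ) c y) := by
    rw [pd_sub (differentiableAt_const _) hN, pd_const, h.metric.pd_gradInner_self h.smooth hy,
      zero_sub]
  unfold scaleBot
  have hi : DifferentiableAt ℝ (fun z => (2 * σ z)⁻¹) y := hder.differentiableAt.comp y hs
  rw [pd_mul ((differentiableAt_const _).fun_sub hN) hi, h1, h2]
  have h3 : ∑ c, schouten γ a c y * raise γ (grad σ) c y
      = - (σ y)⁻¹ * (∑ c, covDeriv γ (grad σ) a c y * raise γ (grad σ) c y
        + scaleBot γ σ y * grad σ a y) := by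
    rw [← h.metric.sum_lower_raise (v := grad σ) hy a]
    simp only [h.schouten_eq hd hd2 hy, Finset.mul_sum, mul_add, Finset.sum_add_distrib, add_mul]
    congr 1 <;> exact Finset.sum_congr rfl fun e _ => by ring
  rw [h3, scaleBot, grad]
  field_simp
  ring

end IsEinsteinScale

end TractorCalculus

namespace TractorCalculus

variable {d : ℕ} {U : Set (Coord d)} {y : Coord d}

/-! ### Contraction of tractors with a parallel tractor -/

/-- Tractor indices as a sum type. -/
def tractorIndexEquiv (d : ℕ) : TractorIndex d ≃ Unit ⊕ Fin d ⊕ Unit where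
  toFun
    | .top => .inl ()
    | .mid a => .inr (.inl a)
    | .bot => .inr (.inr ())
  invFun
    | .inl _ => .top
    | .inr (.inl a) => .mid a
    | .inr (.inr _) => .bot
  left_inv A := by cases A <;> rfl
  right_inv A := by rcases A with _ | _ | _ <;> rfl

lemma sum_tractorIndex (f : TractorIndex d → ℝ) :
    ∑ A, f A = f .top + ∑ a, f (.mid a) + f .bot := by
  rw [← (tractorIndexEquiv d).symm.sum_comp]
  simp [tractorIndexEquiv, add_assoc]

lemma tractorDeriv_zero (γ : MetricField d) (a : Fin d) (V : TractorField d 0)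
    (A : Fin 0 → TractorIndex d) : tractorDeriv γ a V A = pd a (V A) := by
  ext z
  simp [tractorDeriv]

/-- The contraction `F^{A_1} ⋯ F^{A_m} V_{A_1 ⋯ A_m}` with a tractor `F` with upper index. -/
def contractUpper {m : ℕ} (F : TractorIndex d → Coord d → ℝ) (V : TractorField d m)
    (y : Coord d) : ℝ :=
  ∑ A : Fin m → TractorIndex d, (∏ s, F (A s) y) * V A y

/-- The tractor `F`, with upper index, is parallel on `U` for the tractor connection of `γ`. -/
structure IsParallelOn (U : Set (Coord d)) (γ : MetricField d)
    (F : TractorIndex d → Coord d → ℝ) : Prop where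
  smooth : ∀ A, ContDiffOn ℝ ∞ (F A) U
  pd_eq : ∀ z ∈ U, ∀ a A, pd a (F A) z = ∑ B, F B z * tractorConn γ a B A z

lemma pd_prod {ι : Type*} [Fintype ι] [DecidableEq ι] {f : ι → Coord d → ℝ}
    (hf : ∀ i, DifferentiableAt ℝ (f i) y) (a : Fin d) :
    pd a (fun z => ∏ i, f i z) y = ∑ i, pd a (f i) y * ∏ j ∈ Finset.univ.erase i, f j y := by
  simp only [pd]
  rw [(HasFDerivAt.finsetProd fun i _ => (hf i).hasFDerivAt).fderiv]
  simp [mul_comm]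

lemma differentiableAt_prod {ι : Type*} [Fintype ι] {f : ι → Coord d → ℝ}
    (hf : ∀ i, DifferentiableAt ℝ (f i) y) : DifferentiableAt ℝ (fun z => ∏ i, f i z) y :=
  by
  classical exact (HasFDerivAt.finsetProd fun i _ => (hf i).hasFDerivAt).differentiableAt

/-- Exchanging the entry $A_s$ with the auxiliary index $B$ is an involution of the summation range.
It serves to rename the dummy index in the connection terms. -/
lemma sum_update_swap {m : ℕ} {T : Type*} [Fintype T] [DecidableEq T] (s : Fin m)
    (Φ : (Fin m → T) → T → ℝ) :
    ∑ A : Fin m → T, ∑ B, Φ A B = ∑ A : Fin m → T, ∑ B, Φ (Function.update A s B) (A s) := by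
  rw [← Fintype.sum_prod_type', ← Fintype.sum_prod_type']
  refine Fintype.sum_equiv (Function.Involutive.toPerm
    (fun p : (Fin m → T) × T => (Function.update p.1 s p.2, p.1 s)) ?_) _ _ ?_
  · rintro ⟨A, B⟩; simp
  · rintro ⟨A, B⟩
    change Φ A B = Φ (Function.update (Function.update A s B) s (A s)) (Function.update A s B s)
    simp

lemma prod_update_erase {m : ℕ} {T : Type*} (s : Fin m) (A : Fin m → T) (B : T) (f : T → ℝ) :
    ∏ t, f (Function.update A s B t) = f B * ∏ t ∈ Finset.univ.erase s, f (A t) := by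
  rw [← Finset.mul_prod_erase Finset.univ _ (Finset.mem_univ s)]
  simp only [Function.update_self]
  congr 1
  refine Finset.prod_congr rfl fun t ht => ?_
  rw [Function.update_of_ne (Finset.ne_of_mem_erase ht)]

namespace IsParallelOn

variable {γ : MetricField d} {F : TractorIndex d → Coord d → ℝ} {m : ℕ} {V : TractorField d m}

/-- The Leibniz rule with $\nabla F=0$: differentiating the $s$-th factor $F$ yields the connection
term acting on the $s$-th index of $V$. -/
lemma contract_tractorDeriv (hF : IsParallelOn U γ F) (hU : IsOpen U)
    (hV : ∀ A, ContDiffOn ℝ ∞ (V A) U) (hy : y ∈ U) (a : Fin d) :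
    contractUpper F (tractorDeriv γ a V) y = pd a (contractUpper F V) y := by
  have hF' : ∀ A, DifferentiableAt ℝ (F A) y :=
    fun A => differentiableAt_of_smoothOn hU (hF.smooth A) hy
  have hV' : ∀ A, DifferentiableAt ℝ (V A) y := fun A => differentiableAt_of_smoothOn hU (hV A) hy
  unfold contractUpper
  rw [pd_sum_mul _ (fun A => differentiableAt_prod fun s => hF' (A s)) hV']
  simp only [tractorDeriv, mul_add, Finset.sum_add_distrib]
  rw [add_comm]
  congr 1
  simp only [pd_prod (fun s => hF' _), hF.pd_eq y hy, Finset.sum_mul, Finset.mul_sum]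
  rw [Finset.sum_comm, Finset.sum_comm (s := Finset.univ (α := Fin m → TractorIndex d))
    (t := Finset.univ (α := Fin m))]
  refine Finset.sum_congr rfl fun s _ => ?_
  -- On one side the connection acts on a factor $F$, on the other on an index of $V$; swapping the
  -- two summed indices identifies them.
  rw [sum_update_swap s]
  refine Finset.sum_congr rfl fun A _ => Finset.sum_congr rfl fun B _ => ?_
  rw [prod_update_erase s A B (fun T => F T y)]
  simp only [Function.update_self, Function.update_idem, Function.update_eq_self]
  ring

end IsParallelOn

section Smooth

variable {γ : MetricField d} (hγ : IsMetricOn U γ) {m : ℕ} {V : TractorField d m}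
include hγ

lemma IsMetricOn.smooth_ricci (a b : Fin d) : ContDiffOn ℝ ∞ (ricci γ a b) U := by
  unfold ricci riemann
  have hΓ := hγ.smooth_christoffel
  refine ContDiffOn.sum fun c _ => ContDiffOn.add (ContDiffOn.sub ?_ ?_) (ContDiffOn.sum fun f _ =>
    ((hΓ _ _ _).mul (hΓ _ _ _)).sub ((hΓ _ _ _).mul (hΓ _ _ _)))
  · exact smoothOn_pd hγ.isOpen (hΓ _ _ _) _
  · exact smoothOn_pd hγ.isOpen (hΓ _ _ _) _

lemma IsMetricOn.smooth_schoutenTrace : ContDiffOn ℝ ∞ (schoutenTrace γ) U :=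
  (ContDiffOn.sum fun a _ => ContDiffOn.sum fun b _ =>
    (hγ.smooth_inv a b).mul (hγ.smooth_ricci a b)).div_const _

lemma IsMetricOn.smooth_schouten (a b : Fin d) : ContDiffOn ℝ ∞ (schouten γ a b) U :=
  ((hγ.smooth_ricci a b).sub (hγ.smooth_schoutenTrace.mul (hγ.smooth a b))).div_const _

lemma smooth_tractorConn (a : Fin d) (A B : TractorIndex d) :
    ContDiffOn ℝ ∞ (tractorConn γ a A B) U := by
  rcases A with _ | b | _ <;> rcases B with _ | c | _
  · exact contDiffOn_const
  · exact contDiffOn_const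
  · exact contDiffOn_const
  · exact hγ.smooth_schouten a b
  · exact (hγ.smooth_christoffel c a b).neg
  · exact hγ.smooth a b
  · exact contDiffOn_const
  · exact (ContDiffOn.sum fun e _ => (hγ.smooth_schouten a e).mul (hγ.smooth_inv e c)).neg
  · exact contDiffOn_const

lemma smooth_tractorDeriv (hV : ∀ A, ContDiffOn ℝ ∞ (V A) U) (a : Fin d)
    (A : Fin m → TractorIndex d) : ContDiffOn ℝ ∞ (tractorDeriv γ a V A) U :=
  (smoothOn_pd hγ.isOpen (hV A) a).add (ContDiffOn.sum fun _ _ => ContDiffOn.sum fun _ _ =>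
    (smooth_tractorConn hγ a _ _).mul (hV _))

lemma smooth_tractorLaplacian (hV : ∀ A, ContDiffOn ℝ ∞ (V A) U)
    (A : Fin m → TractorIndex d) : ContDiffOn ℝ ∞ (tractorLaplacian γ V A) U :=
  (ContDiffOn.sum fun a _ => ContDiffOn.sum fun b _ => (hγ.smooth_inv a b).mul
    ((smooth_tractorDeriv hγ (smooth_tractorDeriv hγ hV b) a A).sub (ContDiffOn.sum fun c _ =>
      (hγ.smooth_christoffel c a b).mul (smooth_tractorDeriv hγ hV c A)))).neg

lemma smooth_thomasD (hV : ∀ A, ContDiffOn ℝ ∞ (V A) U) (w : ℝ)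
    (A : Fin (m + 1) → TractorIndex d) : ContDiffOn ℝ ∞ (thomasD γ w V A) U := by
  unfold thomasD
  rcases A 0 with _ | a | _
  · exact contDiffOn_const.mul (hV _)
  · exact contDiffOn_const.mul (smooth_tractorDeriv hγ hV a _)
  · exact (smooth_tractorLaplacian hγ hV _).sub
      ((contDiffOn_const.mul hγ.smooth_schoutenTrace).mul (hV _))

lemma smooth_iterThomasD {u : Coord d → ℝ} (hu : ContDiffOn ℝ ∞ u U) (w : ℝ) :
    ∀ (m : ℕ) (A : Fin m → TractorIndex d), ContDiffOn ℝ ∞ (iterThomasD γ w u m A) U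
  | 0, _ => hu
  | m + 1, A => smooth_thomasD hγ (smooth_iterThomasD hu w m) _ A

end Smooth

/-- The scalar operator `F^A D_A` on densities of weight `w`. -/
def contractedD (γ : MetricField d) (F : TractorIndex d → Coord d → ℝ) (w : ℝ) (u : Coord d → ℝ)
    (y : Coord d) : ℝ :=
  F .top y * ((d + 2 * w - 2) * w * u y) + ∑ a, F (.mid a) y * ((d + 2 * w - 2) * pd a u y)
    + F .bot y * (laplaceBeltrami γ u y - w * schoutenTrace γ y * u y)

/-- The full contraction is a scalar in the chosen scale, so applying the commutation with $\nabla$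
twice leaves the Laplacian of functions. -/
lemma contractUpper_tractorLaplacian {γ : MetricField d} {F : TractorIndex d → Coord d → ℝ} {m : ℕ}
    {V : TractorField d m} (hF : IsParallelOn U γ F) (hγ : IsMetricOn U γ)
    (hV : ∀ A, ContDiffOn ℝ ∞ (V A) U) (hy : y ∈ U) :
    contractUpper F (tractorLaplacian γ V) y = laplaceBeltrami γ (contractUpper F V) y := by
  have h1 : ∀ a b, pd a (pd b (contractUpper F V)) y
      = contractUpper F (tractorDeriv γ a (tractorDeriv γ b V)) y := by
    intro a b
    rw [hF.contract_tractorDeriv hγ.isOpen (smooth_tractorDeriv hγ hV b) hy]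
    exact pd_congr hγ.isOpen
      (fun z hz => (hF.contract_tractorDeriv hγ.isOpen hV hz b).symm) a hy
  simp only [laplaceBeltrami, h1, ← hF.contract_tractorDeriv hγ.isOpen hV hy]
  simp only [contractUpper, tractorLaplacian, mul_neg, Finset.sum_neg_distrib, Finset.mul_sum,
    mul_sub, Finset.sum_sub_distrib]
  congr 2
  · rw [Finset.sum_comm]
    refine Finset.sum_congr rfl fun a _ => ?_
    rw [Finset.sum_comm]
    exact Finset.sum_congr rfl fun b _ => Finset.sum_congr rfl fun A _ => by ring
  · rw [Finset.sum_comm]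
    refine Finset.sum_congr rfl fun a _ => ?_
    rw [Finset.sum_comm]
    refine Finset.sum_congr rfl fun b _ => ?_
    rw [Finset.sum_comm]
    exact Finset.sum_congr rfl fun c _ => Finset.sum_congr rfl fun A _ => by ring

/-- Although $D$ is not a derivation, its slots involve only $V$, $\nabla V$ and $\Delta V$, and
contraction with a parallel tractor commutes with each. The new index is contracted separately,
which yields one scalar factor $F\cdot D$. -/
lemma contractUpper_thomasD {γ : MetricField d} {F : TractorIndex d → Coord d → ℝ} {m : ℕ}
    {V : TractorField d m} (hF : IsParallelOn U γ F) (hγ : IsMetricOn U γ)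
    (hV : ∀ A, ContDiffOn ℝ ∞ (V A) U) (w : ℝ) (hy : y ∈ U) :
    contractUpper F (thomasD γ w V) y = contractedD γ F w (contractUpper F V) y := by
  unfold contractedD
  rw [← contractUpper_tractorLaplacian hF hγ hV hy]
  simp only [← hF.contract_tractorDeriv hγ.isOpen hV hy]
  have h : contractUpper F (thomasD γ w V) y = ∑ B : TractorIndex d,
      ∑ A : Fin m → TractorIndex d, F B y * ((∏ s, F (A s) y) * thomasD γ w V (Fin.cons B A) y) := by
    rw [contractUpper, ← (Fin.consEquiv fun _ => TractorIndex d).sum_comp, Fintype.sum_prod_type]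
    refine Finset.sum_congr rfl fun B _ => Finset.sum_congr rfl fun A _ => ?_
    simp [Fin.prod_univ_succ, Fin.consEquiv, mul_assoc]
  rw [h, sum_tractorIndex]
  simp only [thomasD, Fin.cons_zero, Fin.tail_cons, contractUpper, Finset.mul_sum,
    ← Finset.sum_sub_distrib, mul_sub]
  congr 1
  · congr 1
    · exact Finset.sum_congr rfl fun A _ => by ring
    · exact Finset.sum_congr rfl fun a _ => Finset.sum_congr rfl fun A _ => by ring
  · exact Finset.sum_congr rfl fun A _ => by ring

lemma contractUpper_tractorYamabe {γ : MetricField d} {F : TractorIndex d → Coord d → ℝ} {m : ℕ}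
    {V : TractorField d m} (hF : IsParallelOn U γ F) (hγ : IsMetricOn U γ)
    (hV : ∀ A, ContDiffOn ℝ ∞ (V A) U) (hy : y ∈ U) :
    contractUpper F (tractorYamabe γ V) y = laplaceBeltrami γ (contractUpper F V) y
      - (1 - (d : ℝ) / 2) * schoutenTrace γ y * contractUpper F V y := by
  rw [← contractUpper_tractorLaplacian hF hγ hV hy]
  simp only [contractUpper, tractorYamabe, Finset.mul_sum, ← Finset.sum_sub_distrib, mul_sub]
  exact Finset.sum_congr rfl fun A _ => by ring

/-- The tractor `I = (1/d) D σ` with its index raised. -/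
def scaleTractorUpper (γ : MetricField d) (σ : Coord d → ℝ) :
    TractorIndex d → Coord d → ℝ
  | .top => scaleBot γ σ
  | .mid a => raise γ (grad σ) a
  | .bot => σ

namespace IsEinsteinScale

variable {γ : MetricField d} {σ : Coord d → ℝ} (h : IsEinsteinScale U γ σ) (hd : 2 < d)
include h hd

lemma scaleTractor_bot (hy : y ∈ U) : scaleTractor γ σ .bot y = scaleBot γ σ y := by
  have hd0 : (d : ℝ) ≠ 0 := by positivity
  have hd1 : (d : ℝ) ≠ 1 := by exact_mod_cast (by omega : d ≠ 1)
  have h0 := (h.pos y hy).ne'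
  have e : tractorLaplacian γ (fun _ : Fin 0 → TractorIndex d => σ) (Fin.tail fun _ : Fin 1 => TractorIndex.bot) y
      = laplaceBeltrami γ σ y := by
    simp only [tractorLaplacian, laplaceBeltrami, tractorDeriv_zero]
  simp only [scaleTractor, thomasD]
  -- In $\Delta\sigma-J\sigma$ the Laplacian of $\sigma$ cancels against the one in $J$; the
  -- remainder is $d\rho$.
  rw [e, h.schoutenTrace_eq hd1 hy, scaleBot]
  field_simp
  ring

omit h in
lemma scaleTractor_top : scaleTractor γ σ .top y = σ y := by
  have hd0 : (d : ℝ) ≠ 0 := by positivity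
  simp only [scaleTractor, thomasD]
  field_simp
  ring

omit h in
lemma scaleTractor_mid (a : Fin d) : scaleTractor γ σ (.mid a) y = pd a σ y := by
  have hd0 : (d : ℝ) ≠ 0 := by positivity
  have e : tractorDeriv γ a (fun _ : Fin 0 → TractorIndex d => σ) (Fin.tail fun _ : Fin 1 => TractorIndex.mid a) y
      = pd a σ y := by
    rw [tractorDeriv_zero]
  simp only [scaleTractor, thomasD]
  rw [e]
  field_simp
  ring

lemma raise_scaleTractor (hy : y ∈ U) (A : TractorIndex d) :
    ∑ B, tractorMetric γ A B y * scaleTractor γ σ B y = scaleTractorUpper γ σ A y := by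
  rw [sum_tractorIndex]
  rcases A with _ | a | _
  · simp [tractorMetric, scaleTractorUpper, h.scaleTractor_bot hd hy]
  · simp [tractorMetric, scaleTractorUpper, scaleTractor_mid hd, raise, grad]
  · simp [tractorMetric, scaleTractorUpper, scaleTractor_top hd]

lemma contract_eq {m : ℕ} (V : TractorField d m) (hy : y ∈ U) :
    contract γ (scaleTractor γ σ) V y = contractUpper (scaleTractorUpper γ σ) V y := by
  simp only [contract, contractUpper, h.raise_scaleTractor hd hy]

/-- The tractor metric exchanges the top and bottom slots. With the index raised, the case `top` is
therefore the equation for $d\rho$, the case `mid` is the formula for the Schouten tensor with an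
index raised, and the case `bot` only says that the middle slot is $d\sigma$. -/
lemma isParallelOn : IsParallelOn U γ (scaleTractorUpper γ σ) where
  smooth A := by
    rcases A with _ | a | _
    · exact h.smooth_scaleBot
    · exact h.metric.smooth_raise (fun b => smoothOn_pd h.metric.isOpen h.smooth b) a
    · exact h.smooth
  pd_eq z hz a A := by
    have hd1 : (d : ℝ) ≠ 1 := by exact_mod_cast (by omega : d ≠ 1)
    have hd2 : (d : ℝ) ≠ 2 := by exact_mod_cast (by omega : d ≠ 2)
    have h0 := (h.pos z hz).ne'
    rw [sum_tractorIndex]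
    rcases A with _ | c | _
    · simp only [scaleTractorUpper, tractorConn, mul_zero, zero_add, add_zero]
      rw [h.pd_scaleBot hd1 hd2 hz]
      exact Finset.sum_congr rfl fun c _ => mul_comm _ _
    · simp only [scaleTractorUpper, tractorConn]
      rw [h.metric.pd_raise (v := grad σ) (fun b => smoothOn_pd h.metric.isOpen h.smooth b) hz]
      have e : ∑ e, schouten γ a e z * (γ z)⁻¹ e c = - (σ z)⁻¹ *
          (∑ e, (γ z)⁻¹ c e * covDeriv γ (grad σ) a e z
            + scaleBot γ σ z * if a = c then 1 else 0) := by
        rw [← h.metric.sum_mul_inv hz]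
        simp only [h.schouten_eq hd1 hd2 hz, Finset.mul_sum, mul_add, Finset.sum_add_distrib,
          add_mul]
        congr 1 <;> refine Finset.sum_congr rfl fun e _ => ?_
        · rw [h.metric.inv_symm hz c e]; ring
        · ring
      have e2 : ∑ f, christoffel γ c a f z * raise γ (grad σ) f z
          = ∑ b, raise γ (grad σ) b z * christoffel γ c a b z :=
        Finset.sum_congr rfl fun f _ => mul_comm _ _
      rw [e, e2]
      simp only [mul_neg, Finset.sum_neg_distrib]
      split_ifs <;> field_simp <;> ring
    · simp only [scaleTractorUpper, tractorConn, mul_zero, zero_add, add_zero]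
      rw [← grad, ← h.metric.sum_raise_lower (v := grad σ) hz a]
      exact Finset.sum_congr rfl fun b _ => by rw [h.metric.symm z hz a b]

end IsEinsteinScale

end TractorCalculus

namespace TractorCalculus

variable {d : ℕ} {U : Set (Coord d)} {y : Coord d}

/-! ### Locality -/

lemma christoffel_congr (hU : IsOpen U) {γ γ' : MetricField d} (h : Set.EqOn γ γ' U)
    (c a b : Fin d) : Set.EqOn (christoffel γ c a b) (christoffel γ' c a b) U := by
  intro z hz
  have hp : ∀ e a b, pd e (fun z => γ z a b) z = pd e (fun z => γ' z a b) z := fun e a b =>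
    pd_congr hU (fun x hx => by rw [h hx]) e hz
  simp only [christoffel, hp, h hz]

lemma riemann_congr (hU : IsOpen U) {γ γ' : MetricField d} (h : Set.EqOn γ γ' U)
    (a b c e : Fin d) : Set.EqOn (riemann γ a b c e) (riemann γ' a b c e) U := by
  intro z hz
  have hp : ∀ f c a b, pd f (christoffel γ c a b) z = pd f (christoffel γ' c a b) z :=
    fun f c a b => pd_congr hU (christoffel_congr hU h c a b) f hz
  simp only [riemann, hp, christoffel_congr hU h _ _ _ hz]

lemma ricci_congr (hU : IsOpen U) {γ γ' : MetricField d} (h : Set.EqOn γ γ' U)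
    (a b : Fin d) : Set.EqOn (ricci γ a b) (ricci γ' a b) U := fun z hz => by
  simp only [ricci, riemann_congr hU h _ _ _ _ hz]

lemma laplaceBeltrami_congr (hU : IsOpen U) {γ γ' : MetricField d} (h : Set.EqOn γ γ' U)
    {f f' : Coord d → ℝ} (hf : Set.EqOn f f' U) :
    Set.EqOn (laplaceBeltrami γ f) (laplaceBeltrami γ' f') U := by
  intro z hz
  have h1 : ∀ a, pd a f z = pd a f' z := fun a => pd_congr hU hf a hz
  have h2 : ∀ a b, pd a (pd b f) z = pd a (pd b f') z := fun a b =>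
    pd_congr hU (pd_congr hU hf b) a hz
  simp only [laplaceBeltrami, h1, h2, h hz, christoffel_congr hU h _ _ _ hz]

lemma contractedD_congr (hU : IsOpen U) (γ : MetricField d) (F : TractorIndex d → Coord d → ℝ)
    (w : ℝ) {f f' : Coord d → ℝ} (hf : Set.EqOn f f' U) :
    Set.EqOn (contractedD γ F w f) (contractedD γ F w f') U := by
  intro z hz
  have h1 : ∀ a, pd a f z = pd a f' z := fun a => pd_congr hU hf a hz
  simp only [contractedD, h1, laplaceBeltrami_congr hU (fun _ _ => rfl) hf hz, hf hz]

/-! ### The Laplacian of products, powers, and in conformally related metrics -/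

namespace IsMetricOn

variable {γ : MetricField d} (hγ : IsMetricOn U γ) {f h σ : Coord d → ℝ}
include hγ

lemma laplaceBeltrami_mul (hf : ContDiffOn ℝ ∞ f U) (hh : ContDiffOn ℝ ∞ h U) (hy : y ∈ U) :
    laplaceBeltrami γ (fun z => f z * h z) y = laplaceBeltrami γ f y * h y
      + f y * laplaceBeltrami γ h y - 2 * gradInner γ f h y := by
  have hd : ∀ {k : Coord d → ℝ}, ContDiffOn ℝ ∞ k U → ∀ z ∈ U, DifferentiableAt ℝ k z :=
    fun hk z hz => differentiableAt_of_smoothOn hγ.isOpen hk hz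
  have h1 : ∀ b, Set.EqOn (pd b fun z => f z * h z) (fun z => pd b f z * h z + f z * pd b h z) U :=
    fun b z hz => pd_mul (hd hf z hz) (hd hh z hz) b
  have hfb : ∀ b, DifferentiableAt ℝ (pd b f) y := fun b => hd (smoothOn_pd hγ.isOpen hf b) y hy
  have hhb : ∀ b, DifferentiableAt ℝ (pd b h) y := fun b => hd (smoothOn_pd hγ.isOpen hh b) y hy
  have h2 : ∀ a b, pd a (pd b fun z => f z * h z) y = pd a (pd b f) y * h y + f y * pd a (pd b h) y
      + (pd a f y * pd b h y + pd b f y * pd a h y) := by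
    intro a b
    rw [pd_congr hγ.isOpen (h1 b) a hy,
      pd_add ((hfb b).fun_mul (hd hh y hy)) ((hd hf y hy).fun_mul (hhb b)),
      pd_mul (hfb b) (hd hh y hy), pd_mul (hd hf y hy) (hhb b)]
    ring
  have h3 : ∀ a b, covDeriv γ (grad fun z => f z * h z) a b y
      = covDeriv γ (grad f) a b y * h y + f y * covDeriv γ (grad h) a b y
        + (pd a f y * pd b h y + pd b f y * pd a h y) := by
    intro a b
    simp only [covDeriv, grad, h2, fun c => h1 c hy, mul_add, Finset.sum_add_distrib, sub_mul,
      mul_sub, Finset.sum_mul, Finset.mul_sum]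
    have e : ∀ c, christoffel γ c a b y * (f y * pd c h y)
        = f y * (christoffel γ c a b y * pd c h y) := fun c => by ring
    simp only [e, mul_assoc]
    ring
  have h4 : gradInner γ f h y = ∑ a, ∑ b, (γ y)⁻¹ a b * (pd a f y * pd b h y) := by
    simp only [gradInner, raise, grad, Finset.sum_mul]
    rw [Finset.sum_comm]
    exact Finset.sum_congr rfl fun a _ => Finset.sum_congr rfl fun b _ => by
      rw [hγ.inv_symm hy]; ring
  have h5 : gradInner γ f h y = ∑ a, ∑ b, (γ y)⁻¹ a b * (pd b f y * pd a h y) := by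
    simp only [gradInner, raise, grad, Finset.sum_mul]
    exact Finset.sum_congr rfl fun a _ => Finset.sum_congr rfl fun b _ => by ring
  have h6 : 2 * gradInner γ f h y = ∑ a, ∑ b, (γ y)⁻¹ a b * (pd a f y * pd b h y)
      + ∑ a, ∑ b, (γ y)⁻¹ a b * (pd b f y * pd a h y) := by rw [← h4, ← h5]; ring
  rw [h6]
  simp only [laplaceBeltrami_eq, h3, mul_add, Finset.sum_add_distrib, neg_mul, mul_neg,
    Finset.sum_mul, Finset.mul_sum]
  have e : ∀ a b, (γ y)⁻¹ a b * (f y * covDeriv γ (grad h) a b y)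
      = f y * ((γ y)⁻¹ a b * covDeriv γ (grad h) a b y) := fun a b => by ring
  simp only [e, mul_assoc]
  ring

lemma gradInner_mul_right (hf : ContDiffOn ℝ ∞ f U) (hh : ContDiffOn ℝ ∞ h U) (hy : y ∈ U) :
    gradInner γ σ (fun z => f z * h z) y = gradInner γ σ f y * h y + f y * gradInner γ σ h y := by
  simp only [gradInner, pd_mul (differentiableAt_of_smoothOn hγ.isOpen hf hy)
    (differentiableAt_of_smoothOn hγ.isOpen hh hy), mul_add, Finset.sum_add_distrib,
    Finset.sum_mul, Finset.mul_sum]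
  congr 1 <;> exact Finset.sum_congr rfl fun a _ => by ring

variable (hσ : ContDiffOn ℝ ∞ σ U) (hσ0 : ∀ z ∈ U, 0 < σ z) (w : ℝ)
include hσ hσ0

omit hγ in
lemma smooth_rpow : ContDiffOn ℝ ∞ (fun z => σ z ^ w) U := fun z hz =>
  (hσ z hz).rpow_const_of_ne (hσ0 z hz).ne'

lemma pd_rpow (hy : y ∈ U) (a : Fin d) :
    pd a (fun z => σ z ^ w) y = w * σ y ^ (w - 1) * pd a σ y :=
  pd_comp (Real.hasDerivAt_rpow_const (Or.inl (hσ0 y hy).ne'))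
    (differentiableAt_of_smoothOn hγ.isOpen hσ hy) a

lemma gradInner_rpow_right (hy : y ∈ U) :
    gradInner γ h (fun z => σ z ^ w) y = w * σ y ^ (w - 1) * gradInner γ h σ y := by
  simp only [gradInner, hγ.pd_rpow hσ hσ0 w hy, Finset.mul_sum]
  exact Finset.sum_congr rfl fun a _ => by ring

lemma laplaceBeltrami_rpow (hy : y ∈ U) :
    laplaceBeltrami γ (fun z => σ z ^ w) y = w * σ y ^ (w - 1) * laplaceBeltrami γ σ y
      - w * (w - 1) * σ y ^ (w - 2) * gradInner γ σ σ y := by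
  have hs := fun a => differentiableAt_of_smoothOn hγ.isOpen (smoothOn_pd hγ.isOpen hσ a) hy
  have hr := differentiableAt_of_smoothOn hγ.isOpen (smooth_rpow hσ hσ0 (w - 1)) hy
  have h2 : ∀ a b, pd a (pd b fun z => σ z ^ w) y
      = w * (w - 1) * σ y ^ (w - 2) * (pd a σ y * pd b σ y)
        + w * σ y ^ (w - 1) * pd a (pd b σ) y := by
    intro a b
    rw [pd_congr hγ.isOpen (fun z hz => hγ.pd_rpow hσ hσ0 w hz b) a hy,
      pd_mul ((differentiableAt_const w).fun_mul hr) (hs b),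
      pd_mul (differentiableAt_const w) hr, hγ.pd_rpow hσ hσ0 (w - 1) hy, pd_const,
      show w - 1 - 1 = w - 2 by ring]
    ring
  have h3 : ∀ a b, covDeriv γ (grad fun z => σ z ^ w) a b y
      = w * (w - 1) * σ y ^ (w - 2) * (pd a σ y * pd b σ y)
        + w * σ y ^ (w - 1) * covDeriv γ (grad σ) a b y := by
    intro a b
    simp only [covDeriv, grad, h2, hγ.pd_rpow hσ hσ0 w hy, mul_sub, Finset.mul_sum]
    rw [add_sub_assoc]
    congr 2
    exact Finset.sum_congr rfl fun c _ => by ring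
  have h5 : gradInner γ σ σ y = ∑ a, ∑ b, (γ y)⁻¹ a b * (pd a σ y * pd b σ y) := by
    simp only [gradInner, raise, grad, Finset.sum_mul]
    exact Finset.sum_congr rfl fun a _ => Finset.sum_congr rfl fun b _ => by ring
  rw [h5]
  simp only [laplaceBeltrami_eq, h3, mul_add, Finset.sum_add_distrib, mul_neg, Finset.mul_sum]
  have e1 : ∀ a b, (γ y)⁻¹ a b * (w * (w - 1) * σ y ^ (w - 2) * (pd a σ y * pd b σ y))
      = w * (w - 1) * σ y ^ (w - 2) * ((γ y)⁻¹ a b * (pd a σ y * pd b σ y)) :=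
    fun a b => by ring
  have e2 : ∀ a b, (γ y)⁻¹ a b * (w * σ y ^ (w - 1) * covDeriv γ (grad σ) a b y)
      = w * σ y ^ (w - 1) * ((γ y)⁻¹ a b * covDeriv γ (grad σ) a b y) := fun a b => by ring
  simp only [e1, e2]
  ring

/-- The first-order term is the trace $\gamma^{ab}C^c{}_{ab}=(2-d)\upsilon^c$ of the difference
tensor, with $\upsilon=-d\log\sigma$. -/
lemma laplaceBeltrami_conformalMetric (hy : y ∈ U) (f : Coord d → ℝ) :
    laplaceBeltrami (conformalMetric σ γ) f y = σ y ^ 2 * laplaceBeltrami γ f y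
      + (d - 2) * σ y * gradInner γ σ f y := by
  have h0 := (hσ0 y hy).ne'
  have h1 : ∀ a b, covDeriv (conformalMetric σ γ) (grad f) a b y = covDeriv γ (grad f) a b y
      + (σ y)⁻¹ * (pd a f y * pd b σ y + pd b f y * pd a σ y - γ y a b * gradInner γ σ f y) := by
    intro a b
    have e := sum_covector_mul_conformalDiff (g := γ y) (v := fun e => negLogDeriv σ e y)
      (t := fun e => raise γ (negLogDeriv σ) e y) (fun c => pd c f y) a b
    have e' : ∑ c, pd c f y * raise γ (negLogDeriv σ) c y = - (σ y)⁻¹ * gradInner γ σ f y := by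
      simp only [raise_negLogDeriv, gradInner, Finset.mul_sum]
      exact Finset.sum_congr rfl fun c _ => by ring
    rw [e'] at e
    simp only [covDeriv, grad, hγ.christoffel_conformalMetric hσ hσ0 hy, add_mul,
      Finset.sum_add_distrib]
    rw [show ∑ c, conformalDiff (γ y) (fun e => negLogDeriv σ e y)
      (fun e => raise γ (negLogDeriv σ) e y) c a b * pd c f y = _ from
      (Finset.sum_congr rfl fun c _ => mul_comm _ _).trans e]
    simp only [negLogDeriv]
    ring
  have h2 : ∑ a, ∑ b, (γ y)⁻¹ a b * (pd a f y * pd b σ y) = gradInner γ σ f y := by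
    simp only [gradInner, raise, grad, Finset.sum_mul]
    exact Finset.sum_congr rfl fun a _ => Finset.sum_congr rfl fun b _ => by ring
  have h3 : ∑ a, ∑ b, (γ y)⁻¹ a b * (pd b f y * pd a σ y) = gradInner γ σ f y := by
    rw [Finset.sum_comm, ← h2]
    exact Finset.sum_congr rfl fun a _ => Finset.sum_congr rfl fun b _ => by
      rw [hγ.inv_symm hy]
  have h4 : ∑ a, ∑ b, (γ y)⁻¹ a b * γ y a b = d := by
    have e : ∀ a, ∑ b, (γ y)⁻¹ a b * γ y a b = 1 := fun a => by
      rw [← if_pos (c := a = a) (t := (1 : ℝ)) (e := 0) rfl, ← hγ.sum_inv_mul hy]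
      exact Finset.sum_congr rfl fun b _ => by rw [hγ.symm y hy a b]
    simp [e]
  have e : ∀ a b, (conformalMetric σ γ y)⁻¹ a b * covDeriv (conformalMetric σ γ) (grad f) a b y
      = σ y ^ 2 * ((γ y)⁻¹ a b * covDeriv γ (grad f) a b y)
        + σ y * ((γ y)⁻¹ a b * (pd a f y * pd b σ y))
        + σ y * ((γ y)⁻¹ a b * (pd b f y * pd a σ y))
        - σ y * gradInner γ σ f y * ((γ y)⁻¹ a b * γ y a b) := by
    intro a b
    rw [h1, hγ.inv_conformalMetric hσ0 hy]
    field_simp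
    ring
  simp only [laplaceBeltrami_eq, e, Finset.sum_add_distrib, Finset.sum_sub_distrib,
    ← Finset.mul_sum, h2, h3, h4]
  ring

end IsMetricOn

/-- The iterated product `∏_{j < m} (Δ + (w - j)(d + w - j - 1))` applied to a function. -/
def laplaceProduct (γ : MetricField d) (w : ℝ) (f : Coord d → ℝ) : ℕ → Coord d → ℝ
  | 0 => f
  | m + 1 => fun z => laplaceBeltrami γ (laplaceProduct γ w f m) z
      + (w - m) * (d + (w - m) - 1) * laplaceProduct γ w f m z

lemma IsMetricOn.smooth_laplaceProduct {γ : MetricField d} (hγ : IsMetricOn U γ)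
    {f : Coord d → ℝ} (hf : ContDiffOn ℝ ∞ f U) (w : ℝ) :
    ∀ m, ContDiffOn ℝ ∞ (laplaceProduct γ w f m) U
  | 0 => hf
  | m + 1 => (hγ.smooth_laplaceBeltrami (hγ.smooth_laplaceProduct hf w m)).add
      (contDiffOn_const.mul (hγ.smooth_laplaceProduct hf w m))

namespace IsEinsteinScale

variable {γ : MetricField d} {σ : Coord d → ℝ} (h : IsEinsteinScale U γ σ) (hd : 2 < d)
include h hd

/-- Conformal covariance of `I^A D_A`: in the Einstein scale it is a shifted Laplacian. -/
lemma contractedD_rpow_mul {f : Coord d → ℝ} (hf : ContDiffOn ℝ ∞ f U) (w : ℝ) (hy : y ∈ U) :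
    contractedD γ (scaleTractorUpper γ σ) w (fun z => σ z ^ w * f z) y
      = σ y ^ (w - 1) * (laplaceBeltrami (conformalMetric σ γ) f y + w * (d + w - 1) * f y) := by
  have hd1 : (d : ℝ) ≠ 1 := by exact_mod_cast (by omega : d ≠ 1)
  have hpos := h.pos y hy
  have h0 := hpos.ne'
  have hw := IsMetricOn.smooth_rpow h.smooth h.pos w
  have e1 : ∑ a, scaleTractorUpper γ σ (.mid a) y *
      ((d + 2 * w - 2) * pd a (fun z => σ z ^ w * f z) y)
      = (d + 2 * w - 2) * gradInner γ σ (fun z => σ z ^ w * f z) y := by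
    simp only [scaleTractorUpper, gradInner, Finset.mul_sum]
    exact Finset.sum_congr rfl fun a _ => by ring
  unfold contractedD
  rw [e1, h.metric.gradInner_mul_right hw hf hy, h.metric.laplaceBeltrami_mul hw hf hy,
    h.metric.gradInner_rpow_right h.smooth h.pos w hy,
    h.metric.laplaceBeltrami_rpow h.smooth h.pos w hy,
    h.metric.laplaceBeltrami_conformalMetric h.smooth h.pos hy,
    h.metric.gradInner_comm (fun z => σ z ^ w) f hy, h.metric.gradInner_rpow_right h.smooth h.pos w hy,
    h.schoutenTrace_eq hd1 hy, h.metric.gradInner_comm f σ hy]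
  simp only [scaleTractorUpper, scaleBot]
  -- All powers are written as multiples of $\sigma^{w-2}$, which leaves a rational identity. The
  -- terms in $\Delta\sigma$ and in $|d\sigma|^2$ cancel there, leaving the constant $w(d+w-1)$.
  have p1 : σ y ^ (w - 1) = σ y ^ (w - 2) * σ y := by
    rw [← Real.rpow_add_one h0]; congr 1; ring
  have p0 : σ y ^ w = σ y ^ (w - 2) * σ y * σ y := by
    rw [← p1, ← Real.rpow_add_one h0]; congr 1; ring
  rw [p0, p1]
  field_simp
  ring

/-- Each factor $I\cdot D$ maps $\sigma^{w'}f'$ to $\sigma^{w'-1}$ times a shifted Laplacian of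
$f'$. The result has the same form with weight one lower, so the step can be repeated. -/
lemma contractUpper_iterThomasD {u f : Coord d → ℝ} (hf : ContDiffOn ℝ ∞ f U) (w : ℝ)
    (hu : Set.EqOn u (fun z => σ z ^ w * f z) U) (m : ℕ) (hy : y ∈ U) :
    contractUpper (scaleTractorUpper γ σ) (iterThomasD γ w u m) y
      = σ y ^ (w - m) * laplaceProduct (conformalMetric σ γ) w f m y := by
  have hus : ContDiffOn ℝ ∞ u U :=
    ((IsMetricOn.smooth_rpow h.smooth h.pos w).mul hf).congr hu
  have hc := h.metric.conformal h.smooth h.pos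
  induction m generalizing y with
  | zero => simpa [contractUpper, iterThomasD, laplaceProduct] using hu hy
  | succ m ih =>
    rw [iterThomasD, contractUpper_thomasD (h.isParallelOn hd) h.metric
      (smooth_iterThomasD h.metric hus w m) _ hy,
      contractedD_congr h.metric.isOpen γ _ _ (fun z hz => ih hz) hy,
      h.contractedD_rpow_mul hd (hc.smooth_laplaceProduct hf w m) _ hy]
    simp only [laplaceProduct]
    push_cast
    rw [sub_add_eq_sub_sub]

/-- At the weight where $\Box$ acts, $I\cdot D$ equals $\sigma\Box$. The contraction in $P_k$ thus
becomes an iterate of $k/2$ factors, and the remaining powers of $\sigma$ do not vanish. -/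
lemma gjmsLocal_eq_zero_iff {u f : Coord d → ℝ} (hf : ContDiffOn ℝ ∞ f U) {k m : ℕ} (hm : 0 < m)
    (hk : k = 2 * m) (hu : Set.EqOn u (fun z => σ z ^ (((k : ℝ) - d) / 2) * f z) U) (hy : y ∈ U) :
    gjmsLocal γ σ k u y = 0
      ↔ laplaceProduct (conformalMetric σ γ) (((k : ℝ) - d) / 2) f m y = 0 := by
  obtain ⟨m, rfl⟩ : ∃ m', m = m' + 1 := ⟨m - 1, by omega⟩
  have hpos := h.pos y hy
  set w : ℝ := ((k : ℝ) - d) / 2 with hw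
  have hus : ContDiffOn ℝ ∞ u U :=
    ((IsMetricOn.smooth_rpow h.smooth h.pos w).mul hf).congr hu
  have hc := h.metric.conformal h.smooth h.pos
  have hkm : k / 2 - 1 = m := by omega
  -- Here $m$ has been replaced by $k/2-1$, the number of factors $D$ in $P_k$; the weight reached
  -- is the Yamabe weight.
  have hwm : w - m = 1 - d / 2 := by
    rw [hw, hk]; push_cast; ring
  have hV := smooth_iterThomasD h.metric hus w m
  have key : contractedD γ (scaleTractorUpper γ σ) (w - m)
      (contractUpper (scaleTractorUpper γ σ) (iterThomasD γ w u m)) y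
      = σ y * contractUpper (scaleTractorUpper γ σ) (tractorYamabe γ (iterThomasD γ w u m)) y := by
    rw [contractUpper_tractorYamabe (h.isParallelOn hd) h.metric hV hy]
    -- This coefficient multiplies the top and middle slots of $D$; only the bottom slot, paired
    -- with $\sigma$, remains.
    have : (d : ℝ) + 2 * (1 - d / 2) - 2 = 0 := by ring
    simp only [contractedD, hwm, this, zero_mul, mul_zero, Finset.sum_const_zero, zero_add]
    rfl
  rw [← contractUpper_thomasD (h.isParallelOn hd) h.metric hV _ hy,
    show thomasD γ (w - m) (iterThomasD γ w u m) = iterThomasD γ w u (m + 1) from rfl,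
    h.contractUpper_iterThomasD hd hf w hu (m + 1) hy] at key
  rw [gjmsLocal, hkm, h.contract_eq hd _ hy]
  have hz : σ y ^ (1 - ((k / 2 : ℕ) : ℤ)) ≠ 0 := zpow_ne_zero _ hpos.ne'
  have hr : σ y ^ (w - ((m + 1 : ℕ) : ℝ)) ≠ 0 := (Real.rpow_pos_of_pos hpos _).ne'
  rw [mul_eq_zero_iff_left hz, ← mul_eq_zero_iff_left hpos.ne', ← key, mul_eq_zero_iff_left hr]

end IsEinsteinScale

end TractorCalculus

namespace TractorCalculus

variable {d : ℕ} {U U' : Set (Coord d)} {y : Coord d}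

/-! ### Invariance of the Laplacian under changes of coordinates -/

lemma fderiv_stdVec {φ : Coord d → Coord d} (hφ : DifferentiableAt ℝ φ y) (a : Fin d) :
    fderiv ℝ φ y (stdVec a) = ∑ i, pd a (fun z => φ z i) y • stdVec i := by
  ext i
  have e : pd a (fun z => φ z i) y = fderiv ℝ φ y (stdVec a) i := by
    have := ((EuclideanSpace.proj (𝕜 := ℝ) i).hasFDerivAt.comp y hφ.hasFDerivAt).fderiv
    simp only [pd]
    rw [show (fun z => φ z i) = (EuclideanSpace.proj (𝕜 := ℝ) i) ∘ φ from rfl, this]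
    rfl
  rw [← e]
  simp [stdVec, Pi.single_apply]

lemma pd_comp_map {φ : Coord d → Coord d} {h : Coord d → ℝ}
    (hφ : ∀ i, DifferentiableAt ℝ (fun z => φ z i) y) (hh : DifferentiableAt ℝ h (φ y))
    (a : Fin d) :
    pd a (fun z => h (φ z)) y = ∑ i, pd i h (φ y) * pd a (fun z => φ z i) y := by
  have hφ' : DifferentiableAt ℝ φ y := differentiableAt_euclidean.2 hφ
  have h2 := (hh.hasFDerivAt.comp y hφ'.hasFDerivAt).fderiv
  simp only [pd]
  rw [show (fun z => h (φ z)) = h ∘ φ from rfl, h2, ContinuousLinearMap.comp_apply,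
    fderiv_stdVec hφ', map_sum]
  refine Finset.sum_congr rfl fun i _ => ?_
  rw [map_smul, smul_eq_mul, mul_comm]
  rfl

/-- `φ` is a smooth map pulling back the metric `γ'` on `U'` to the metric `γ` on `U`. -/
structure IsLocalIsometryOn (U U' : Set (Coord d)) (γ γ' : MetricField d)
    (φ : Coord d → Coord d) : Prop where
  metric : IsMetricOn U γ
  metric' : IsMetricOn U' γ'
  smooth : ∀ i, ContDiffOn ℝ ∞ (fun z => φ z i) U
  mapsTo : Set.MapsTo φ U U'
  pullback : ∀ z ∈ U, ∀ a b, γ z a b = ∑ i, ∑ j, γ' (φ z) i j *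
    (pd a (fun x => φ x i) z * pd b (fun x => φ x j) z)

/-- The Jacobian matrix `∂_a φ^i`. -/
def jacobian (φ : Coord d → Coord d) (y : Coord d) : Matrix (Fin d) (Fin d) ℝ :=
  Matrix.of fun i a => pd a (fun x => φ x i) y

/-- The algebra behind the transformation of the first-kind symbols: $G$ and $dG$ stand for the
target metric and its derivatives, $J$ and $H$ for the first and second derivatives of the map, $D$
for the derivatives of the pulled-back metric. -/
lemma koszul_pullback {G : Fin d → Fin d → ℝ} {dG : Fin d → Fin d → Fin d → ℝ}
    {J : Fin d → Fin d → ℝ} {H : Fin d → Fin d → Fin d → ℝ} (hG : ∀ i j, G i j = G j i)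
    (hH : ∀ i a b, H i a b = H i b a) {D : Fin d → Fin d → Fin d → ℝ}
    (hD : ∀ a b e, D a b e = ∑ i, ∑ j, ((∑ k, dG k i j * J k a) * (J i b * J j e)
      + G i j * (H i a b * J j e + J i b * H j a e))) (a b e : Fin d) :
    (1 / 2) * (D a b e + D b a e - D e a b) = ∑ l, J l e *
      (∑ i, ∑ j, (1 / 2) * (dG i j l + dG j i l - dG l i j) * (J i a * J j b)
        + ∑ k, G l k * H k a b) := by
  -- $T$ collects the terms with derivatives of the metric, $S$ those with second derivatives of the
  -- map. Since $S$ is symmetric in its first two arguments, four of the six $S$-terms cancel in the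
  -- Koszul combination and the other two agree.
  let T : Fin d → Fin d → Fin d → ℝ := fun a b e =>
    ∑ k, ∑ i, ∑ j, dG k i j * (J k a * J i b * J j e)
  let S : Fin d → Fin d → Fin d → ℝ := fun a b e => ∑ i, ∑ j, G i j * (H i a b * J j e)
  have hS : ∀ a b e, S a b e = S b a e := fun a b e => by simp only [S, fun i => hH i a b]
  have hDTS : ∀ a b e, D a b e = T a b e + S a b e + S a e b := by
    intro a b e
    rw [hD]
    simp only [mul_add, Finset.sum_add_distrib, Finset.sum_mul, ← add_assoc]
    congr 1
    · congr 1
      simp only [T]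
      rw [Finset.sum_comm (s := Finset.univ) (t := Finset.univ)
        (f := fun k i => ∑ j, dG k i j * (J k a * J i b * J j e))]
      refine Finset.sum_congr rfl fun i _ => ?_
      rw [Finset.sum_comm]
      exact Finset.sum_congr rfl fun k _ => Finset.sum_congr rfl fun j _ => by ring
    · simp only [S]
      rw [Finset.sum_comm]
      exact Finset.sum_congr rfl fun i _ => Finset.sum_congr rfl fun j _ => by
        rw [hG j i]; ring
  have hT1 : ∑ l, ∑ i, ∑ j, J l e * (dG i j l * (J i a * J j b)) = T a b e := by
    simp only [T]
    rw [Finset.sum_comm]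
    refine Finset.sum_congr rfl fun i _ => ?_
    rw [Finset.sum_comm]
    exact Finset.sum_congr rfl fun j _ => Finset.sum_congr rfl fun l _ => by ring
  have hT2 : ∑ l, ∑ i, ∑ j, J l e * (dG j i l * (J i a * J j b)) = T b a e := by
    simp only [T]
    rw [Finset.sum_comm (s := Finset.univ) (t := Finset.univ)
        (f := fun k i => ∑ j, dG k i j * (J k b * J i a * J j e)), Finset.sum_comm]
    refine Finset.sum_congr rfl fun i _ => ?_
    rw [Finset.sum_comm]
    exact Finset.sum_congr rfl fun j _ => Finset.sum_congr rfl fun l _ => by ring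
  have hT3 : ∑ l, ∑ i, ∑ j, J l e * (dG l i j * (J i a * J j b)) = T e a b :=
    Finset.sum_congr rfl fun l _ => Finset.sum_congr rfl fun i _ =>
      Finset.sum_congr rfl fun j _ => by ring
  have hS1 : ∑ l, ∑ k, J l e * (G l k * H k a b) = S a b e := by
    simp only [S]
    rw [Finset.sum_comm]
    exact Finset.sum_congr rfl fun i _ => Finset.sum_congr rfl fun j _ => by
      rw [hG j i]; ring
  have hR : ∀ l, J l e * (∑ i, ∑ j, (1 / 2) * (dG i j l + dG j i l - dG l i j) * (J i a * J j b)
        + ∑ k, G l k * H k a b)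
      = (1 / 2) * ∑ i, ∑ j, J l e * (dG i j l * (J i a * J j b))
        + (1 / 2) * ∑ i, ∑ j, J l e * (dG j i l * (J i a * J j b))
        - (1 / 2) * ∑ i, ∑ j, J l e * (dG l i j * (J i a * J j b))
        + ∑ k, J l e * (G l k * H k a b) := by
    intro l
    rw [mul_add, Finset.mul_sum (f := fun k => G l k * H k a b)]
    congr 1
    simp only [Finset.mul_sum, ← Finset.sum_add_distrib, ← Finset.sum_sub_distrib]
    exact Finset.sum_congr rfl fun i _ => Finset.sum_congr rfl fun j _ => by ring
  have hM : ∀ f : Fin d → ℝ, ∑ l, 1 / 2 * f l = 1 / 2 * ∑ l, f l := fun f =>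
    (Finset.mul_sum _ _ _).symm
  simp only [hR, Finset.sum_add_distrib, Finset.sum_sub_distrib]
  rw [hM, hM, hM, hT1, hT2, hT3, hS1, hDTS, hDTS, hDTS]
  rw [hS b a e, hS e a b, hS e b a]
  ring

namespace IsLocalIsometryOn

variable {γ γ' : MetricField d} {φ : Coord d → Coord d} (h : IsLocalIsometryOn U U' γ γ' φ)
include h

lemma diffAt (hy : y ∈ U) (i : Fin d) : DifferentiableAt ℝ (fun z => φ z i) y :=
  differentiableAt_of_smoothOn h.metric.isOpen (h.smooth i) hy

lemma eq_mul (hy : y ∈ U) : γ y = (jacobian φ y).transpose * γ' (φ y) * jacobian φ y := by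
  ext a b
  rw [h.pullback y hy]
  simp only [Matrix.mul_apply, jacobian, Matrix.transpose_apply, Matrix.of_apply, Finset.sum_mul]
  rw [Finset.sum_comm]
  exact Finset.sum_congr rfl fun i _ => Finset.sum_congr rfl fun j _ => by ring

/-- The pulled-back metric is assumed nondegenerate, which forces the Jacobian to be invertible
without an inverse map being given. -/
lemma isUnit_det_jacobian (hy : y ∈ U) : IsUnit (jacobian φ y).det := by
  have := h.metric.isUnit_det y hy
  rw [h.eq_mul hy, Matrix.det_mul] at this
  exact isUnit_of_mul_isUnit_right this

lemma sum_inv (hy : y ∈ U) (i j : Fin d) : ∑ a, ∑ b, (γ y)⁻¹ a b *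
    (pd a (fun x => φ x i) y * pd b (fun x => φ x j) y) = (γ' (φ y))⁻¹ i j := by
  have hJ := h.isUnit_det_jacobian hy
  set J := jacobian φ y with hJd
  have h1 : J * (γ y)⁻¹ * J.transpose = (γ' (φ y))⁻¹ := by
    symm
    refine Matrix.inv_eq_left_inv ?_
    have h2 : (J * (γ y)⁻¹ * J.transpose * γ' (φ y)) * J = 1 * J := by
      have : (J * (γ y)⁻¹ * J.transpose * γ' (φ y)) * J
          = J * ((γ y)⁻¹ * (J.transpose * γ' (φ y) * J)) := by simp only [Matrix.mul_assoc]
      rw [this, ← h.eq_mul hy, Matrix.nonsing_inv_mul _ (h.metric.isUnit_det y hy), Matrix.mul_one,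
        Matrix.one_mul]
    exact (Matrix.isUnit_iff_isUnit_det J).2 hJ |>.mul_right_cancel h2
  rw [← h1]
  simp only [Matrix.mul_apply, hJd, jacobian, Matrix.transpose_apply, Matrix.of_apply,
    Finset.sum_mul]
  rw [Finset.sum_comm]
  exact Finset.sum_congr rfl fun i _ => Finset.sum_congr rfl fun j _ => by ring

lemma pd_metric_pullback (hy : y ∈ U) (a b e : Fin d) :
    pd a (fun z => γ z b e) y = ∑ i, ∑ j,
      ((∑ k, pd k (fun z => γ' z i j) (φ y) * pd a (fun x => φ x k) y)
          * (pd b (fun x => φ x i) y * pd e (fun x => φ x j) y)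
        + γ' (φ y) i j * (pd a (pd b fun x => φ x i) y * pd e (fun x => φ x j) y
          + pd b (fun x => φ x i) y * pd a (pd e fun x => φ x j) y)) := by
  have hU := h.metric.isOpen
  have hφ := fun i => h.diffAt hy i
  have hφ2 : ∀ b i, DifferentiableAt ℝ (pd b fun x => φ x i) y := fun b i =>
    differentiableAt_of_smoothOn hU (smoothOn_pd hU (h.smooth i) b) hy
  have hG : ∀ i j, DifferentiableAt ℝ (fun z => γ' z i j) (φ y) := fun i j =>
    h.metric'.diffAt (h.mapsTo hy) i j
  have hG' : ∀ i j, DifferentiableAt ℝ (fun z => γ' (φ z) i j) y := fun i j =>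
    (hG i j).comp y (differentiableAt_euclidean.2 hφ)
  have hm : ∀ i j, DifferentiableAt ℝ
      (fun z => pd b (fun x => φ x i) z * pd e (fun x => φ x j) z) y := fun i j =>
    (hφ2 b i).fun_mul (hφ2 e j)
  rw [pd_congr hU (fun z hz => h.pullback z hz b e) a hy, pd_sum _ fun i _ =>
    DifferentiableAt.fun_sum fun j _ => (hG' i j).fun_mul (hm i j)]
  refine Finset.sum_congr rfl fun i _ => ?_
  rw [pd_sum_mul _ (fun j => hG' i j) (fun j => hm i j)]
  refine Finset.sum_congr rfl fun j _ => ?_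
  rw [pd_comp_map hφ (hG i j), pd_mul (hφ2 b i) (hφ2 e j)]

/-- The transformation law of the Christoffel symbols. -/
lemma christoffel_pullback (hy : y ∈ U) (k a b : Fin d) :
    ∑ c, pd c (fun x => φ x k) y * christoffel γ c a b y
      = ∑ i, ∑ j, christoffel γ' k i j (φ y)
          * (pd a (fun x => φ x i) y * pd b (fun x => φ x j) y)
        + pd a (pd b fun x => φ x k) y := by
  have hy' := h.mapsTo hy
  let J := jacobian φ y
  let X : Fin d → ℝ := fun k => ∑ c, pd c (fun x => φ x k) y * christoffel γ c a b y
  let Y : Fin d → ℝ := fun k => ∑ i, ∑ j, christoffel γ' k i j (φ y)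
          * (pd a (fun x => φ x i) y * pd b (fun x => φ x j) y)
        + pd a (pd b fun x => φ x k) y
  -- Both sides are compared after multiplication by this invertible matrix: this lowers the free
  -- index, so that only first-kind symbols appear and `koszul_pullback` applies.
  have hdet : (J.transpose * γ' (φ y)).det ≠ 0 := by
    rw [Matrix.det_mul, Matrix.det_transpose]
    exact mul_ne_zero (h.isUnit_det_jacobian hy).ne_zero (h.metric'.isUnit_det _ hy').ne_zero
  have hX : (J.transpose * γ' (φ y)).mulVec X
      = fun e => ∑ c, γ y e c * christoffel γ c a b y := by
    have e1 : X = J.mulVec fun c => christoffel γ c a b y := rfl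
    rw [e1, Matrix.mulVec_mulVec, ← h.eq_mul hy]
    rfl
  have hY : (J.transpose * γ' (φ y)).mulVec Y = fun e => ∑ l, pd e (fun x => φ x l) y *
      (∑ i, ∑ j, (1 / 2) * (pd i (fun z => γ' z j l) (φ y) + pd j (fun z => γ' z i l) (φ y)
        - pd l (fun z => γ' z i j) (φ y)) * (pd a (fun x => φ x i) y * pd b (fun x => φ x j) y)
        + ∑ k, γ' (φ y) l k * pd a (pd b fun x => φ x k) y) := by
    rw [← Matrix.mulVec_mulVec]
    ext e
    change ∑ l, pd e (fun x => φ x l) y * ((γ' (φ y)).mulVec Y l) = _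
    refine Finset.sum_congr rfl fun l _ => ?_
    congr 1
    simp only [← h.metric'.lower_christoffel hy', Matrix.mulVec, dotProduct, Y, mul_add,
      Finset.sum_add_distrib, Finset.mul_sum, Finset.sum_mul]
    congr 1
    rw [Finset.sum_comm]
    refine Finset.sum_congr rfl fun i _ => ?_
    rw [Finset.sum_comm]
    exact Finset.sum_congr rfl fun j _ => Finset.sum_congr rfl fun l _ => by ring
  have hXY : (J.transpose * γ' (φ y)).mulVec X = (J.transpose * γ' (φ y)).mulVec Y := by
    rw [hX, hY]
    ext e
    rw [h.metric.lower_christoffel hy]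
    exact koszul_pullback (G := γ' (φ y)) (dG := fun k i j => pd k (fun z => γ' z i j) (φ y))
      (J := fun i a => pd a (fun x => φ x i) y) (H := fun i a b => pd a (pd b fun x => φ x i) y)
      (h.metric'.symm _ hy') (fun i a b => pd_comm h.metric.isOpen (h.smooth i) hy a b)
      (D := fun a b e => pd a (fun z => γ z b e) y)
      (fun a b e => h.pd_metric_pullback hy a b e) a b e
  exact congrFun (Matrix.mulVec_injective_of_isUnit ((Matrix.isUnit_iff_isUnit_det _).2
    (IsUnit.mk0 _ hdet)) hXY) k

/-- The Laplacian is invariant under changes of coordinates. -/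
lemma laplaceBeltrami_comp {f : Coord d → ℝ} (hf : ContDiffOn ℝ ∞ f U') (hy : y ∈ U) :
    laplaceBeltrami γ (fun z => f (φ z)) y = laplaceBeltrami γ' f (φ y) := by
  have hU := h.metric.isOpen
  have hU' := h.metric'.isOpen
  have hy' := h.mapsTo hy
  have hφ := fun i => h.diffAt hy i
  have hφ2 : ∀ b i, DifferentiableAt ℝ (pd b fun x => φ x i) y := fun b i =>
    differentiableAt_of_smoothOn hU (smoothOn_pd hU (h.smooth i) b) hy
  have hp : ∀ i, DifferentiableAt ℝ (pd i f) (φ y) := fun i =>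
    differentiableAt_of_smoothOn hU' (smoothOn_pd hU' hf i) hy'
  have h1 : ∀ b, Set.EqOn (pd b fun z => f (φ z))
      (fun z => ∑ i, pd i f (φ z) * pd b (fun x => φ x i) z) U := fun b z hz =>
    pd_comp_map (fun i => h.diffAt hz i) (differentiableAt_of_smoothOn hU' hf (h.mapsTo hz)) b
  have h2 : ∀ a b, covDeriv γ (grad fun z => f (φ z)) a b y
      = ∑ i, ∑ j, (pd a (fun x => φ x i) y * pd b (fun x => φ x j) y)
        * covDeriv γ' (grad f) i j (φ y) := by
    intro a b
    have e1 : pd a (pd b fun z => f (φ z)) y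
        = ∑ i, ∑ j, pd i (pd j f) (φ y) * (pd a (fun x => φ x i) y * pd b (fun x => φ x j) y)
          + ∑ k, pd k f (φ y) * pd a (pd b fun x => φ x k) y := by
      have hpφ : ∀ i, DifferentiableAt ℝ (fun z => pd i f (φ z)) y := fun i =>
        (hp i).comp y (differentiableAt_euclidean.2 hφ)
      rw [pd_congr hU (h1 b) a hy, pd_sum_mul _ hpφ (fun i => hφ2 b i),
        Finset.sum_add_distrib]
      congr 1
      rw [Finset.sum_comm]
      refine Finset.sum_congr rfl fun j _ => ?_
      rw [pd_comp_map hφ (hp j), Finset.sum_mul]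
      exact Finset.sum_congr rfl fun i _ => by ring
    have e2 : ∑ c, christoffel γ c a b y * pd c (fun z => f (φ z)) y
        = ∑ i, ∑ j, (∑ k, christoffel γ' k i j (φ y) * pd k f (φ y))
            * (pd a (fun x => φ x i) y * pd b (fun x => φ x j) y)
          + ∑ k, pd k f (φ y) * pd a (pd b fun x => φ x k) y := by
      have e3 : ∑ c, christoffel γ c a b y * pd c (fun z => f (φ z)) y
          = ∑ k, pd k f (φ y) * ∑ c, pd c (fun x => φ x k) y * christoffel γ c a b y := by
        simp only [fun c => h1 c hy, Finset.mul_sum]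
        rw [Finset.sum_comm]
        exact Finset.sum_congr rfl fun k _ => Finset.sum_congr rfl fun c _ => by ring
      rw [e3]
      simp only [h.christoffel_pullback hy, mul_add, Finset.sum_add_distrib]
      congr 1
      simp only [Finset.mul_sum, Finset.sum_mul]
      rw [Finset.sum_comm]
      refine Finset.sum_congr rfl fun i _ => ?_
      rw [Finset.sum_comm]
      exact Finset.sum_congr rfl fun j _ => Finset.sum_congr rfl fun k _ => by ring
    simp only [covDeriv, grad]
    -- The second derivatives of $\varphi$ from the chain rule and from the Christoffel symbols
    -- cancel: the Hessian is a tensor.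
    rw [e1, e2, add_sub_add_right_eq_sub]
    simp only [← Finset.sum_sub_distrib]
    exact Finset.sum_congr rfl fun i _ => Finset.sum_congr rfl fun j _ => by ring
  simp only [laplaceBeltrami_eq, h2, ← h.sum_inv hy, Finset.mul_sum, Finset.sum_mul]
  congr 1
  calc _ = ∑ a, ∑ i, ∑ j, ∑ b, (γ y)⁻¹ a b * ((pd a (fun x => φ x i) y
        * pd b (fun x => φ x j) y) * covDeriv γ' (grad f) i j (φ y)) := by
        refine Finset.sum_congr rfl fun a _ => ?_
        rw [Finset.sum_comm]
        exact Finset.sum_congr rfl fun i _ => Finset.sum_comm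
    _ = _ := by
        rw [Finset.sum_comm]
        refine Finset.sum_congr rfl fun i _ => ?_
        rw [Finset.sum_comm]
        exact Finset.sum_congr rfl fun j _ => Finset.sum_congr rfl fun a _ =>
          Finset.sum_congr rfl fun b _ => by ring

end IsLocalIsometryOn

end TractorCalculus

namespace PoincareEinstein

open TractorCalculus

variable {n : ℕ} {M : Type*} [TopologicalSpace M] [ChartedSpace (EuclideanHalfSpace (n + 1)) M]

/-! ### Coordinates on the interior -/

/-- The chart target is open only relative to the half-space; intersecting with the interior of the
half-space gives a set open in $\mathbb R^d$, where ordinary derivatives apply. -/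
lemma isOpen_interiorTarget (c : M) : IsOpen (interiorTarget n M c) := by
  have h : interiorTarget n M c = (𝓡∂ (n + 1)).symm ⁻¹' (chartAt _ c).target
      ∩ interior (Set.range (𝓡∂ (n + 1))) := by
    rw [interiorTarget, extChartAt_target, Set.inter_assoc,
      Set.inter_eq_right.2 interior_subset]
  rw [h]
  exact ((chartAt _ c).open_target.preimage (𝓡∂ (n + 1)).continuous_symm).inter isOpen_interior

lemma interiorTarget_eq (c : M) :
    interiorTarget n M c = interior (extChartAt (𝓡∂ (n + 1)) c).target := by
  refine Set.Subset.antisymm ?_ ?_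
  · exact interior_maximal Set.inter_subset_left (isOpen_interiorTarget c)
  · exact Set.subset_inter interior_subset (interior_mono (extChartAt_target_subset_range c))

lemma range_mem_nhds {c : M} {y : Coord (n + 1)} (hy : y ∈ interiorTarget n M c) :
    Set.range (𝓡∂ (n + 1)) ∈ nhds y :=
  Filter.mem_of_superset ((isOpen_interior).mem_nhds hy.2) interior_subset

variable [IsManifold (𝓡∂ (n + 1)) ∞ M]

/-- Being an interior point does not depend on the chart used to test it. -/
lemma mem_interior_iff {c p : M} (hp : p ∈ (extChartAt (𝓡∂ (n + 1)) c).source) :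
    p ∈ interiorOpens n M ↔ extChartAt (𝓡∂ (n + 1)) c p ∈ interiorTarget n M c := by
  rw [interiorTarget_eq]
  rw [extChartAt_source] at hp
  exact (𝓡∂ (n + 1)).isInteriorPoint_iff_of_mem_atlas (by simp : (∞ : ℕ∞ω) ≠ 0)
    (chart_mem_atlas _ c) hp

lemma symm_mem_interior {c : M} {y : Coord (n + 1)} (hy : y ∈ interiorTarget n M c) :
    (extChartAt (𝓡∂ (n + 1)) c).symm y ∈ interiorOpens n M := by
  rw [mem_interior_iff ((extChartAt (𝓡∂ (n + 1)) c).map_target hy.1),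
    (extChartAt (𝓡∂ (n + 1)) c).right_inv hy.1]
  exact hy

lemma chart_mem_interiorTarget (p : interiorOpens n M) :
    extChartAt (𝓡∂ (n + 1)) p.1 p.1 ∈ interiorTarget n M p.1 :=
  (mem_interior_iff (mem_extChartAt_source p.1)).1 p.2

lemma inChart_apply {c : M} {y : Coord (n + 1)} (hy : y ∈ interiorTarget n M c)
    (f : interiorOpens n M → ℝ) :
    inChart c f y = f ⟨(extChartAt (𝓡∂ (n + 1)) c).symm y, symm_mem_interior hy⟩ :=
  dif_pos (symm_mem_interior hy)

lemma inChart_chart (p : interiorOpens n M) (f : interiorOpens n M → ℝ) :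
    inChart p.1 f (extChartAt (𝓡∂ (n + 1)) p.1 p.1) = f p := by
  rw [inChart_apply (chart_mem_interiorTarget p)]
  congr 1
  exact Subtype.ext (extChartAt_to_inv p.1)

lemma contMDiffOn_symm (c : M) : ContMDiffOn 𝓘(ℝ, Coord (n + 1)) (𝓡∂ (n + 1)) ∞
    (extChartAt (𝓡∂ (n + 1)) c).symm (interiorTarget n M c) :=
  (contMDiffOn_extChartAt_symm c).mono Set.inter_subset_left

lemma contMDiffAt_symm {c : M} {y : Coord (n + 1)} (hy : y ∈ interiorTarget n M c) :
    ContMDiffAt 𝓘(ℝ, Coord (n + 1)) (𝓡∂ (n + 1)) ∞ (extChartAt (𝓡∂ (n + 1)) c).symm y :=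
  (contMDiffOn_symm c).contMDiffAt ((isOpen_interiorTarget c).mem_nhds hy)

lemma smoothOn_inChart (c : M) (f : SmoothFun n M) :
    ContDiffOn ℝ ∞ (inChart c f) (interiorTarget n M c) := by
  classical
  intro y hy
  refine ContDiffAt.contDiffWithinAt ?_
  rw [← contMDiffAt_iff_contDiffAt]
  -- The extension by zero need not be smooth on $M$, but the interior is open and smoothness is
  -- only needed at interior points.
  let F : M → ℝ := fun p => if h : p ∈ interiorOpens n M then f ⟨p, h⟩ else 0
  have hF : ContMDiffAt (𝓡∂ (n + 1)) 𝓘(ℝ, ℝ) ∞ F ((extChartAt (𝓡∂ (n + 1)) c).symm y) := by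
    refine (contMDiffAt_subtype_iff (U := interiorOpens n M) (f := F)
      (x := ⟨_, symm_mem_interior hy⟩)).1 ?_
    have : (fun x : interiorOpens n M => F x) = f := by
      ext x
      exact dif_pos x.2
    rw [this]
    exact f.contMDiff _
  exact hF.comp y (contMDiffAt_symm hy)

section Metric

variable (g : Bundle.ContMDiffRiemannianMetric (𝓡∂ (n + 1)) ∞ (EuclideanSpace ℝ (Fin (n + 1)))
    (fun p : M => TangentSpace (𝓡∂ (n + 1)) p))

/-- The differential of the inverse of a chart. -/
abbrev symmDeriv (c : M) (y : Coord (n + 1)) : Coord (n + 1) →L[ℝ]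
    TangentSpace (𝓡∂ (n + 1)) ((extChartAt (𝓡∂ (n + 1)) c).symm y) :=
  mfderivWithin 𝓘(ℝ, Coord (n + 1)) (𝓡∂ (n + 1)) (extChartAt (𝓡∂ (n + 1)) c).symm
    (Set.range (𝓡∂ (n + 1))) y

omit [IsManifold (𝓡∂ (n + 1)) ∞ M] in
lemma symmDeriv_eq {c : M} {y : Coord (n + 1)} (hy : y ∈ interiorTarget n M c) :
    symmDeriv c y = mfderiv 𝓘(ℝ, Coord (n + 1)) (𝓡∂ (n + 1))
      (extChartAt (𝓡∂ (n + 1)) c).symm y :=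
  mfderivWithin_of_mem_nhds (range_mem_nhds hy)

lemma symmDeriv_injective {c : M} {y : Coord (n + 1)} (hy : y ∈ interiorTarget n M c) :
    Function.Injective (symmDeriv c y) :=
  (isInvertible_mfderivWithin_extChartAt_symm hy.1).injective

lemma smoothOn_metricInChart (c : M) (a b : Fin (n + 1)) :
    ContDiffOn ℝ ∞ (fun y => metricInChart g c y a b) (interiorTarget n M c) := by
  rw [← contMDiffOn_iff_contDiffOn]
  -- The coordinate vector fields are smooth: they are images of constant fields under the tangent
  -- map of the inverse chart.
  have hv : ∀ a, ContMDiffOn 𝓘(ℝ, Coord (n + 1)) (𝓡∂ (n + 1)).tangent ∞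
      (fun y => (⟨(extChartAt (𝓡∂ (n + 1)) c).symm y, symmDeriv c y (stdVec a)⟩ :
        TangentBundle (𝓡∂ (n + 1)) M)) (interiorTarget n M c) := by
    intro a
    have h1 := (contMDiffOn_symm (n := n) c).contMDiffOn_tangentMapWithin (m := ∞) (by simp)
      (isOpen_interiorTarget (n := n) c).uniqueMDiffOn
    have h2 : ContMDiffOn 𝓘(ℝ, Coord (n + 1)) (𝓘(ℝ, Coord (n + 1))).tangent ∞
        (fun y => (⟨y, stdVec a⟩ : TangentBundle 𝓘(ℝ, Coord (n + 1)) (Coord (n + 1))))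
        (interiorTarget n M c) :=
      contMDiffOn_vectorSpace_iff_contDiffOn.2 contDiffOn_const
    refine (h1.comp h2 fun y hy => hy).congr fun y hy => ?_
    simp only [Function.comp, tangentMapWithin]
    rw [symmDeriv_eq hy, mfderivWithin_of_mem_nhds ((isOpen_interiorTarget c).mem_nhds hy)]
    rfl
  have hg : ContMDiffOn 𝓘(ℝ, Coord (n + 1)) _ ∞ _ (interiorTarget n M c) :=
    g.contMDiff.comp_contMDiffOn (contMDiffOn_symm c)
  have h := ContMDiffOn.clm_bundle_apply₂ (F₁ := Coord (n + 1)) (F₂ := Coord (n + 1))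
    (F₃ := ℝ) (E₃ := Bundle.Trivial M ℝ) hg (hv a) (hv b)
  intro y hy
  have h' := h y hy
  simp only [Bundle.contMDiffWithinAt_totalSpace] at h'
  exact h'.2

lemma metricInChart_apply (c : M) (y : Coord (n + 1)) (v w : Fin (n + 1) → ℝ) :
    ∑ a, ∑ b, metricInChart g c y a b * (v a * w b)
      = g.inner ((extChartAt (𝓡∂ (n + 1)) c).symm y) (symmDeriv c y (∑ a, v a • stdVec a))
        (symmDeriv c y (∑ b, w b • stdVec b)) := by
  simp only [map_sum, map_smul, sum_apply, smul_apply,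
    smul_eq_mul, Finset.mul_sum]
  rw [Finset.sum_comm]
  refine Finset.sum_congr rfl fun a _ => Finset.sum_congr rfl fun b _ => ?_
  rw [show metricInChart g c y b a = g.inner ((extChartAt (𝓡∂ (n + 1)) c).symm y)
    (symmDeriv c y (stdVec b)) (symmDeriv c y (stdVec a)) from rfl]
  ring

lemma isMetricOn_metricInChart (c : M) :
    IsMetricOn (interiorTarget n M c) (metricInChart g c) where
  isOpen := isOpen_interiorTarget c
  smooth := smoothOn_metricInChart g c
  symm y _ a b := g.symm _ _ _
  isUnit_det y hy := by
    refine IsUnit.mk0 _ fun h0 => ?_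
    -- A kernel vector of a degenerate Gram matrix would give a nonzero tangent vector of length
    -- zero, as the inverse chart has injective differential.
    obtain ⟨v, hv, hv0⟩ := Matrix.exists_mulVec_eq_zero_iff.2 h0
    have h1 : ∑ a, ∑ b, metricInChart g c y a b * (v a * v b) = 0 := by
      have : ∀ a, ∑ b, metricInChart g c y a b * (v a * v b) = v a * 0 := by
        intro a
        rw [← show (metricInChart g c y).mulVec v a = 0 from congrFun hv0 a]
        simp only [Matrix.mulVec, dotProduct, Finset.mul_sum]
        exact Finset.sum_congr rfl fun b _ => by ring
      simp [this]
    rw [metricInChart_apply] at h1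
    refine (g.pos _ _ fun h2 => hv ?_).ne' h1
    have h3 : (∑ a, v a • stdVec a : Coord (n + 1)) = 0 :=
      symmDeriv_injective hy (h2.trans (map_zero _).symm)
    ext a
    have := congrArg (fun z : Coord (n + 1) => z a) h3
    simpa [stdVec, Pi.single_apply] using this

end Metric

end PoincareEinstein

/-! ### Restriction and rescaling of metrics -/

namespace TractorCalculus

variable {d : ℕ} {U V : Set (Coord d)} {γ : MetricField d}

lemma IsMetricOn.mono (hγ : IsMetricOn U γ) (hV : IsOpen V) (hVU : V ⊆ U) : IsMetricOn V γ where
  isOpen := hV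
  smooth a b := (hγ.smooth a b).mono hVU
  symm z hz := hγ.symm z (hVU hz)
  isUnit_det z hz := hγ.isUnit_det z (hVU hz)

lemma IsMetricOn.smul (hγ : IsMetricOn U γ) {ψ : Coord d → ℝ} (hψ : ContDiffOn ℝ ∞ ψ U)
    (hψ0 : ∀ z ∈ U, ψ z ≠ 0) : IsMetricOn U (fun z => ψ z • γ z) where
  isOpen := hγ.isOpen
  smooth a b := hψ.mul (hγ.smooth a b)
  symm z hz a b := by simp [hγ.symm z hz a b]
  isUnit_det z hz := by
    simp only [Matrix.det_smul]
    exact (IsUnit.mk0 _ (pow_ne_zero _ (hψ0 z hz))).mul (hγ.isUnit_det z hz)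

end TractorCalculus

/-! ### Changes of charts on the interior -/

namespace PoincareEinstein

open TractorCalculus

variable {n : ℕ} {M : Type*} [TopologicalSpace M] [ChartedSpace (EuclideanHalfSpace (n + 1)) M]

/-- The change of coordinates from the chart around `c` to the chart around `c'`. -/
def transition (n : ℕ) {M : Type*} [TopologicalSpace M]
    [ChartedSpace (EuclideanHalfSpace (n + 1)) M] (c c' : M) (y : Coord (n + 1)) :
    Coord (n + 1) :=
  extChartAt (𝓡∂ (n + 1)) c' ((extChartAt (𝓡∂ (n + 1)) c).symm y)

/-- The domain of `transition`, within interior points. -/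
def overlap (n : ℕ) {M : Type*} [TopologicalSpace M]
    [ChartedSpace (EuclideanHalfSpace (n + 1)) M] (c c' : M) : Set (Coord (n + 1)) :=
  interiorTarget n M c ∩ (extChartAt (𝓡∂ (n + 1)) c).symm ⁻¹' (extChartAt (𝓡∂ (n + 1)) c').source

lemma symm_transition {c c' : M} {y : Coord (n + 1)} (hy : y ∈ overlap n c c') :
    (extChartAt (𝓡∂ (n + 1)) c').symm (transition n c c' y)
      = (extChartAt (𝓡∂ (n + 1)) c).symm y :=
  (extChartAt (𝓡∂ (n + 1)) c').left_inv hy.2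

lemma isOpen_overlap (c c' : M) : IsOpen (overlap n c c') :=
  ((continuousOn_extChartAt_symm c).mono Set.inter_subset_left).isOpen_inter_preimage
    (isOpen_interiorTarget c) (isOpen_extChartAt_source c')

variable [IsManifold (𝓡∂ (n + 1)) ∞ M]

lemma transition_mapsTo (c c' : M) :
    Set.MapsTo (transition n c c') (overlap n c c') (interiorTarget n M c') := fun _ hy =>
  (mem_interior_iff hy.2).1 (symm_mem_interior hy.1)

lemma contDiffOn_transition (c c' : M) :
    ContDiffOn ℝ ∞ (transition n c c') (overlap n c c') := by
  rw [← contMDiffOn_iff_contDiffOn]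
  have h := (contMDiffOn_extChartAt (I := 𝓡∂ (n + 1)) (n := ∞) (x := c')).comp
    ((contMDiffOn_symm (n := n) c).mono (Set.inter_subset_left : overlap n c c' ⊆ _))
    (fun y hy => by
      have := hy.2
      rwa [Set.mem_preimage, extChartAt_source] at this)
  exact h

lemma inChart_transition {c c' : M} {y : Coord (n + 1)} (hy : y ∈ overlap n c c')
    (f : interiorOpens n M → ℝ) : inChart c' f (transition n c c' y) = inChart c f y := by
  rw [inChart_apply hy.1, inChart_apply (transition_mapsTo c c' hy)]
  congr 1
  exact Subtype.ext (symm_transition hy)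

lemma symmDeriv_transition {c c' : M} {y : Coord (n + 1)} (hy : y ∈ overlap n c c')
    (v : Coord (n + 1)) : (symmDeriv c y v : Coord (n + 1))
      = symmDeriv c' (transition n c c' y) (fderiv ℝ (transition n c c') y v) := by
  have hy' := transition_mapsTo c c' hy
  have hd : DifferentiableAt ℝ (transition n c c') y :=
    ((contDiffOn_transition c c').contDiffAt ((isOpen_overlap c c').mem_nhds hy)).differentiableAt
      (by simp)
  have he : (extChartAt (𝓡∂ (n + 1)) c).symm =ᶠ[nhds y]
      (extChartAt (𝓡∂ (n + 1)) c').symm ∘ transition n c c' :=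
    Filter.eventuallyEq_of_mem ((isOpen_overlap c c').mem_nhds hy)
      fun z hz => (symm_transition hz).symm
  have h1 := mfderiv_comp y ((contMDiffAt_symm hy').mdifferentiableAt (by simp))
    hd.mdifferentiableAt
  rw [symmDeriv_eq hy.1, symmDeriv_eq hy', he.mfderiv_eq, h1, mfderiv_eq_fderiv]
  rfl

section Metric

variable (g : Bundle.ContMDiffRiemannianMetric (𝓡∂ (n + 1)) ∞ (EuclideanSpace ℝ (Fin (n + 1)))
    (fun p : M => TangentSpace (𝓡∂ (n + 1)) p))

/-- All tangent spaces are definitionally the model space, so the same $v$ and $w$ can be read at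
both points; this transports the metric along the equality in `symm_transition`. -/
lemma inner_congr {p q : M} (h : p = q) (v w : EuclideanSpace ℝ (Fin (n + 1))) :
    g.inner p v w = g.inner q v w := by
  subst h; rfl

lemma metricInChart_transition {c c' : M} {y : Coord (n + 1)} (hy : y ∈ overlap n c c')
    (a b : Fin (n + 1)) : metricInChart g c y a b
      = ∑ i, ∑ j, metricInChart g c' (transition n c c' y) i j *
        (pd a (fun x => transition n c c' x i) y * pd b (fun x => transition n c c' x j) y) := by
  have hd : DifferentiableAt ℝ (transition n c c') y :=
    ((contDiffOn_transition c c').contDiffAt ((isOpen_overlap c c').mem_nhds hy)).differentiableAt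
      (by simp)
  rw [metricInChart_apply, ← fderiv_stdVec hd, ← fderiv_stdVec hd]
  have h := inner_congr g (symm_transition hy)
    (symmDeriv c' (transition n c c' y) (fderiv ℝ (transition n c c') y (stdVec a)))
    (symmDeriv c' (transition n c c' y) (fderiv ℝ (transition n c c') y (stdVec b)))
  refine Eq.trans ?_ h.symm
  rw [← symmDeriv_transition hy, ← symmDeriv_transition hy]
  rfl

end Metric

/-! ### The Laplacian of $g_+$ as a global operator, and the Einstein scale -/

namespace Structure

variable (S : Structure n M)

lemma inChart_scale_pos (τ : Scale n M) {c : M} {y : Coord (n + 1)}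
    (hy : y ∈ interiorTarget n M c) : 0 < inChart c τ.1 y := by
  rw [inChart_apply hy]
  exact τ.2 _

lemma isMetricOn_scaleMetric (τ : Scale n M) (c : M) :
    IsMetricOn (interiorTarget n M c) (S.scaleMetric τ c) :=
  (isMetricOn_metricInChart S.g c).smul ((smoothOn_inChart c τ.1).pow 2) fun _ hz =>
    pow_ne_zero _ (inChart_scale_pos τ hz).ne'

lemma isLocalIsometryOn_transition (τ : Scale n M) (c c' : M) :
    IsLocalIsometryOn (overlap n c c') (interiorTarget n M c') (S.scaleMetric τ c)
      (S.scaleMetric τ c') (transition n c c') where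
  metric := (S.isMetricOn_scaleMetric τ c).mono (isOpen_overlap c c') Set.inter_subset_left
  metric' := S.isMetricOn_scaleMetric τ c'
  smooth i := contDiffOn_euclidean.1 (contDiffOn_transition c c') i
  mapsTo := transition_mapsTo c c'
  pullback z hz a b := by
    simp only [scaleMetric, Matrix.smul_apply, smul_eq_mul, inChart_transition hz,
      metricInChart_transition S.g hz a b, Finset.mul_sum, mul_assoc]

/-- The Laplacian of `g_+`, computed at a point in an arbitrary chart. -/
lemma laplacianPlus_symm (f : SmoothFun n M) {c : M} {y : Coord (n + 1)}
    (hy : y ∈ interiorTarget n M c) :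
    S.laplacianPlus f ⟨(extChartAt (𝓡∂ (n + 1)) c).symm y, symm_mem_interior hy⟩
      = laplaceBeltrami (S.scaleMetric S.plusScale c) (inChart c f) y := by
  set p : interiorOpens n M := ⟨(extChartAt (𝓡∂ (n + 1)) c).symm y, symm_mem_interior hy⟩ with hp
  have hy' : y ∈ overlap n c p.1 := ⟨hy, mem_extChartAt_source (I := 𝓡∂ (n + 1)) p.1⟩
  have h := (S.isLocalIsometryOn_transition S.plusScale c p.1).laplaceBeltrami_comp
    (smoothOn_inChart p.1 f) hy'
  rw [← laplaceBeltrami_congr (isOpen_overlap c p.1) (fun _ _ => rfl)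
    (fun z hz => inChart_transition hz f) hy', h]
  rfl

/-- The defining formula changes chart with the point. Near $p$, chart independence replaces it by a
formula in the single chart around $p$, which is visibly smooth. -/
lemma smooth_laplacianPlus (f : SmoothFun n M) :
    ContMDiff (𝓡∂ (n + 1)) 𝓘(ℝ, ℝ) ∞ (S.laplacianPlus f) := by
  intro p
  let F : M → ℝ := fun q => laplaceBeltrami (S.scaleMetric S.plusScale p.1) (inChart p.1 f)
    (extChartAt (𝓡∂ (n + 1)) p.1 q)
  have hF : ContMDiffAt (𝓡∂ (n + 1)) 𝓘(ℝ, ℝ) ∞ F p.1 := by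
    have h1 : ContDiffAt ℝ ∞ (laplaceBeltrami (S.scaleMetric S.plusScale p.1) (inChart p.1 f))
        (extChartAt (𝓡∂ (n + 1)) p.1 p.1) :=
      ((S.isMetricOn_scaleMetric S.plusScale p.1).smooth_laplaceBeltrami
        (smoothOn_inChart p.1 f)).contDiffAt
        ((isOpen_interiorTarget p.1).mem_nhds (chart_mem_interiorTarget p))
    exact h1.contMDiffAt.comp p.1 (contMDiffAt_extChartAt (I := 𝓡∂ (n + 1)))
  refine ((contMDiffAt_subtype_iff (f := F)).2 hF).congr_of_eventuallyEq ?_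
  have hn : {q : interiorOpens n M | q.1 ∈ (extChartAt (𝓡∂ (n + 1)) p.1).source} ∈ nhds p :=
    ((isOpen_extChartAt_source p.1).preimage continuous_subtype_val).mem_nhds
      (mem_extChartAt_source p.1)
  filter_upwards [hn] with q hq
  have hy : extChartAt (𝓡∂ (n + 1)) p.1 q.1 ∈ interiorTarget n M p.1 := (mem_interior_iff hq).1 q.2
  rw [show F q = _ from (S.laplacianPlus_symm f hy).symm]
  congr 1
  exact Subtype.ext ((extChartAt (𝓡∂ (n + 1)) p.1).left_inv hq).symm

lemma laplaceBeltrami_add {d : ℕ} {U : Set (Coord d)} (hU : IsOpen U) (γ : MetricField d)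
    {f h : Coord d → ℝ} (hf : ContDiffOn ℝ ∞ f U) (hh : ContDiffOn ℝ ∞ h U) {y : Coord d}
    (hy : y ∈ U) : laplaceBeltrami γ (fun z => f z + h z) y
      = laplaceBeltrami γ f y + laplaceBeltrami γ h y := by
  have h1 : ∀ b, Set.EqOn (pd b fun z => f z + h z) (fun z => pd b f z + pd b h z) U :=
    fun b z hz => pd_add (differentiableAt_of_smoothOn hU hf hz)
      (differentiableAt_of_smoothOn hU hh hz) b
  have h2 : ∀ a b, pd a (pd b fun z => f z + h z) y = pd a (pd b f) y + pd a (pd b h) y := by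
    intro a b
    rw [pd_congr hU (h1 b) a hy, pd_add (differentiableAt_of_smoothOn hU (smoothOn_pd hU hf b) hy)
      (differentiableAt_of_smoothOn hU (smoothOn_pd hU hh b) hy)]
  simp only [laplaceBeltrami, h2, fun b => h1 b hy, mul_add, Finset.sum_add_distrib, mul_sub,
    Finset.sum_sub_distrib]
  ring

lemma laplaceBeltrami_const_mul {d : ℕ} (γ : MetricField d) (t : ℝ) (f : Coord d → ℝ)
    (y : Coord d) : laplaceBeltrami γ (fun z => t * f z) y = t * laplaceBeltrami γ f y := by
  have h1 : ∀ (b : Fin d) (k : Coord d → ℝ), pd b (fun z => t * k z) = fun z => t * pd b k z := by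
    intro b k
    ext z
    simp only [pd]
    rw [show (fun z => t * k z) = t • k from rfl, fderiv_const_smul_field]
    rfl
  simp only [laplaceBeltrami, h1, mul_neg, Finset.mul_sum, mul_sub]
  congr 1
  refine Finset.sum_congr rfl fun a _ => Finset.sum_congr rfl fun b _ => ?_
  congr 1
  · ring
  · exact Finset.sum_congr rfl fun c _ => by ring

/-- The Laplacian of `g_+` as an operator on the smooth functions on the interior. -/
def laplacianOp : Module.End ℝ (SmoothFun n M) where
  toFun f := ⟨S.laplacianPlus f, S.smooth_laplacianPlus f⟩
  map_add' f h := by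
    ext p
    have e : Set.EqOn (inChart p.1 (f + h : SmoothFun n M))
        (fun z => inChart p.1 f z + inChart p.1 h z) (interiorTarget n M p.1) := fun z hz => by
      simp only [inChart_apply hz]; rfl
    change S.laplacianPlus (f + h) p = S.laplacianPlus f p + S.laplacianPlus h p
    simp only [laplacianPlus]
    rw [laplaceBeltrami_congr (isOpen_interiorTarget p.1) (fun _ _ => rfl) e
      (chart_mem_interiorTarget p), laplaceBeltrami_add (isOpen_interiorTarget p.1) _
        (smoothOn_inChart p.1 f) (smoothOn_inChart p.1 h) (chart_mem_interiorTarget p)]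
  map_smul' t f := by
    ext p
    have e : Set.EqOn (inChart p.1 (t • f : SmoothFun n M))
        (fun z => t * inChart p.1 f z) (interiorTarget n M p.1) := fun z hz => by
      simp only [inChart_apply hz]; rfl
    change S.laplacianPlus (t • f) p = t * S.laplacianPlus f p
    simp only [laplacianPlus]
    rw [laplaceBeltrami_congr (isOpen_interiorTarget p.1) (fun _ _ => rfl) e
      (chart_mem_interiorTarget p), laplaceBeltrami_const_mul]

/-- The product `∏_{j < m} (Δ^{g_+} - s_j (n - s_j))`, `s_j = w + n - j`. -/
def scatteringProduct (w : ℝ) : ℕ → Module.End ℝ (SmoothFun n M)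
  | 0 => 1
  | m + 1 => (S.laplacianOp - algebraMap ℝ _ ((w - m + n) * (n - (w - m + n)))) *
      scatteringProduct w m

/-- The global composition agrees with the iterate in one fixed chart, again by chart independence.
For $s=w-m+n$ one has $-s(n-s)=(w-m)(d+(w-m)-1)$, since $d=n+1$. -/
lemma inChart_scatteringProduct (w : ℝ) (f : SmoothFun n M) (c : M) (m : ℕ) :
    Set.EqOn (inChart c (S.scatteringProduct w m f))
      (laplaceProduct (S.scaleMetric S.plusScale c) w (inChart c f) m) (interiorTarget n M c) := by
  induction m with
  | zero => exact fun _ _ => rfl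
  | succ m ih =>
    intro y hy
    have e : ∀ p, S.scatteringProduct w (m + 1) f p = S.laplacianPlus (S.scatteringProduct w m f) p
        - (w - m + n) * (n - (w - m + n)) * S.scatteringProduct w m f p := fun p => rfl
    rw [inChart_apply hy, e, S.laplacianPlus_symm _ hy,
      ← inChart_apply hy (S.scatteringProduct w m f),
      laplaceBeltrami_congr (isOpen_interiorTarget c) (fun _ _ => rfl) ih hy, ih hy]
    simp only [laplaceProduct]
    push_cast
    ring

/-- $(\tau x)^{-2}\tau^2g=x^{-2}g$: the Einstein metric is recovered from every scale. -/
lemma conformalMetric_scaleMetric (τ : Scale n M) (c : M) :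
    Set.EqOn (conformalMetric (inChart c (S.einsteinScale.1 τ)) (S.scaleMetric τ c))
      (S.scaleMetric S.plusScale c) (interiorTarget n M c) := by
  intro y hy
  have hτ := inChart_scale_pos τ hy
  have h1 : inChart c (S.einsteinScale.1 τ) y
      = inChart c τ.1 y * S.x ((extChartAt (𝓡∂ (n + 1)) c).symm y) := by
    simp only [inChart_apply hy]; rfl
  have h2 : inChart c S.plusScale.1 y = (S.x ((extChartAt (𝓡∂ (n + 1)) c).symm y))⁻¹ := by
    rw [inChart_apply hy]; rfl
  simp only [conformalMetric, scaleMetric, h1, h2, smul_smul]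
  congr 1
  field_simp

lemma isEinsteinScale (τ : Scale n M) (c : M) :
    IsEinsteinScale (interiorTarget n M c) (S.scaleMetric τ c)
      (inChart c (S.einsteinScale.1 τ)) where
  metric := S.isMetricOn_scaleMetric τ c
  smooth := smoothOn_inChart c _
  pos z hz := by
    rw [inChart_apply hz]
    exact mul_pos (τ.2 _) (S.x_interior _ (symm_mem_interior hz))
  ricci_eq z hz a b := by
    have e : Set.EqOn (S.scaleMetric S.plusScale c)
        (fun z => (S.x ((extChartAt (𝓡∂ (n + 1)) c).symm z) ^ 2)⁻¹ • metricInChart S.g c z)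
        (interiorTarget n M c) := fun y hy => by
      have h2 : inChart c S.plusScale.1 y = (S.x ((extChartAt (𝓡∂ (n + 1)) c).symm y))⁻¹ := by
        rw [inChart_apply hy]; rfl
      simp only [scaleMetric, h2, inv_pow]
    have e' := (S.conformalMetric_scaleMetric τ c).trans e
    rw [ricci_congr (isOpen_interiorTarget c) e' a b hz, S.einstein c z hz, e' hz]
    push_cast
    ring

/-- The criterion does not involve $\tau$, so vanishing in one scale at a point implies vanishing in
all scales there. -/
lemma gjms_eq_zero_iff (hn : 2 ≤ n) {k m : ℕ} (hm : 0 < m) (hk : k = 2 * m)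
    (u : Density n M (((k : ℝ) - ((n : ℝ) + 1)) / 2)) (τ : Scale n M) (p : interiorOpens n M) :
    S.gjms k u τ p = 0
      ↔ S.scatteringProduct (((k : ℝ) - ((n : ℝ) + 1)) / 2) m (u.1 S.plusScale) p = 0 := by
  have hw : ((k : ℝ) - ((n : ℝ) + 1)) / 2 = ((k : ℝ) - ((n + 1 : ℕ) : ℝ)) / 2 := by push_cast; rfl
  have hy := chart_mem_interiorTarget p
  have hu : Set.EqOn (inChart p.1 (u.1 τ)) (fun z => inChart p.1 (S.einsteinScale.1 τ) z
      ^ (((k : ℝ) - ((n + 1 : ℕ) : ℝ)) / 2) * inChart p.1 (u.1 S.plusScale) z)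
      (interiorTarget n M p.1) := by
    intro z hz
    simp only [inChart_apply hz]
    rw [u.2 S.plusScale τ, ← hw]
    congr 2
    -- The scale of $g_+$ is $x^{-1}$, so the ratio of scales is $\tau x$, the value of $\sigma$ in
    -- the scale $\tau$.
    exact div_inv_eq_mul _ _
  rw [gjms, (S.isEinsteinScale τ p.1).gjmsLocal_eq_zero_iff (by omega)
    (smoothOn_inChart p.1 (u.1 S.plusScale)) hm hk hu hy, ← hw]
  have hc : Set.EqOn (laplaceProduct (conformalMetric (inChart p.1 (S.einsteinScale.1 τ))
      (S.scaleMetric τ p.1)) (((k : ℝ) - ((n : ℝ) + 1)) / 2) (inChart p.1 (u.1 S.plusScale)) m)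
      (laplaceProduct (S.scaleMetric S.plusScale p.1) (((k : ℝ) - ((n : ℝ) + 1)) / 2)
        (inChart p.1 (u.1 S.plusScale)) m) (interiorTarget n M p.1) := by
    clear hm hk
    induction m with
    | zero => exact fun _ _ => rfl
    | succ m ih =>
      intro z hz
      simp only [laplaceProduct]
      rw [laplaceBeltrami_congr (isOpen_interiorTarget p.1)
        (S.conformalMetric_scaleMetric τ p.1) ih hz, ih hz]
  rw [hc hy, ← S.inChart_scatteringProduct _ _ p.1 m hy, inChart_chart]

end Structure

end PoincareEinstein

/-- The kernel of a product of commuting linear factors with distinct roots. -/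
lemma Module.End.ker_aeval_prod_X_sub_C {K V : Type*} [Field K] [AddCommGroup V] [Module K V]
    (f : Module.End K V) {μ : ℕ → K} (m : ℕ) (hμ : Set.InjOn μ (Set.Iio m)) :
    LinearMap.ker (Polynomial.aeval f
      (∏ j ∈ Finset.range m, (Polynomial.X - Polynomial.C (μ j))))
      = ⨆ i : Fin m, f.eigenspace (μ i) := by
  induction m with
  | zero => rw [iSup_of_empty]; simp [Module.End.one_eq_id]
  | succ m ih =>
    have hc : IsCoprime (∏ j ∈ Finset.range m, (Polynomial.X - Polynomial.C (μ j)))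
        (Polynomial.X - Polynomial.C (μ m)) :=
      IsCoprime.prod_left fun j hj => Polynomial.isCoprime_X_sub_C_of_isUnit_sub
        (sub_ne_zero.2 fun h => (Finset.mem_range.1 hj).ne
          (hμ (Set.mem_Iio.2 ((Finset.mem_range.1 hj).trans m.lt_succ_self)) m.lt_succ_self
            h)).isUnit
    rw [Finset.prod_range_succ, ← Polynomial.sup_ker_aeval_eq_ker_aeval_mul_of_coprime f hc,
      ih (hμ.mono (Set.Iio_subset_Iio m.le_succ))]
    have h1 : LinearMap.ker (Polynomial.aeval f (Polynomial.X - Polynomial.C (μ m)))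
        = f.eigenspace (μ m) := by
      rw [Module.End.eigenspace_def]
      simp [Algebra.algebraMap_eq_smul_one]
    rw [h1]
    refine le_antisymm (sup_le (iSup_le fun i => ?_) ?_) (iSup_le fun i => ?_)
    · exact le_iSup (fun i : Fin (m + 1) => f.eigenspace (μ i)) i.castSucc
    · exact le_iSup (fun i : Fin (m + 1) => f.eigenspace (μ i)) (Fin.last m)
    · refine Fin.lastCases ?_ (fun i => ?_) i
      · exact le_sup_right
      · exact (le_iSup (fun i : Fin m => f.eigenspace (μ i)) i).trans le_sup_left

namespace PoincareEinstein

open TractorCalculus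

variable {n : ℕ} {M : Type*} [TopologicalSpace M] [ChartedSpace (EuclideanHalfSpace (n + 1)) M]
  [IsManifold (𝓡∂ (n + 1)) ∞ M]

namespace Structure

variable (S : Structure n M)

lemma scatteringProduct_eq_aeval (w : ℝ) (m : ℕ) : S.scatteringProduct w m
    = Polynomial.aeval S.laplacianOp (∏ j ∈ Finset.range m,
      (Polynomial.X - Polynomial.C ((w - (j : ℕ) + n) * (n - (w - (j : ℕ) + n))))) := by
  induction m with
  | zero => simp [scatteringProduct]
  | succ m ih =>
    rw [Finset.prod_range_succ, mul_comm, map_mul, ← ih, scatteringProduct, map_sub,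
      Polynomial.aeval_X, Polynomial.aeval_C]

/-- A density is determined by its value in the Einstein scale. -/
def densityEquiv (w : ℝ) : Density n M w ≃ₗ[ℝ] SmoothFun n M where
  toFun u := u.1 S.plusScale
  map_add' _ _ := rfl
  map_smul' _ _ := rfl
  invFun f := ⟨fun τ => ⟨fun p => (S.einsteinScale.1 τ p) ^ w * f p, by
      intro p
      have hpos : 0 < S.einsteinScale.1 τ p := mul_pos (τ.2 p) (S.x_interior _ p.2)
      exact ((Real.contDiffAt_rpow_const_of_ne hpos.ne').contMDiffAt.comp p
        ((S.einsteinScale.1 τ).contMDiff p)).mul (f.contMDiff p)⟩, by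
    intro τ τ' p
    have h1 := τ.2 p
    have h2 := τ'.2 p
    have h3 := S.x_interior _ p.2
    change (τ'.1 p * S.x p) ^ w * f p = (τ'.1 p / τ.1 p) ^ w * ((τ.1 p * S.x p) ^ w * f p)
    rw [← mul_assoc, ← Real.mul_rpow (by positivity) (by positivity)]
    congr 2
    field_simp⟩
  left_inv u := by
    ext τ p
    have h3 := S.x_interior _ p.2
    change (τ.1 p * S.x p) ^ w * u.1 S.plusScale p = u.1 τ p
    rw [u.2 S.plusScale τ]
    congr 2
    exact (div_inv_eq_mul _ _).symm
  right_inv f := by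
    ext p
    have h3 := S.x_interior _ p.2
    change ((S.x p)⁻¹ * S.x p) ^ w * f p = f p
    rw [inv_mul_cancel₀ h3.ne', Real.one_rpow, one_mul]

end Structure

end PoincareEinstein

end

theorem proposition5p2 {n : ℕ} (hn : 3 ≤ n) {M : Type*} [TopologicalSpace M] [T2Space M]
    [CompactSpace M] [ChartedSpace (EuclideanHalfSpace (n + 1)) M]
    [IsManifold (𝓡∂ (n + 1)) ∞ M] (S : PoincareEinstein.Structure n M)
    (k : ℕ) (hk : Even k) (hk0 : 0 < k) :
    ∃ (N : Submodule ℝ (PoincareEinstein.Density n M (((k : ℝ) - ((n : ℝ) + 1)) / 2)))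
      (V : Fin (k / 2) →
        Submodule ℝ (PoincareEinstein.Density n M (((k : ℝ) - ((n : ℝ) + 1)) / 2))),
      (N : Set _) = S.gjmsNull k ∧
      (∀ i, (V i : Set _) = S.scatteringNull (((k : ℝ) - ((n : ℝ) + 1)) / 2)
        (((k : ℝ) + n + 1 - 2 * ((i : ℝ) + 1)) / 2)) ∧
      iSupIndep V ∧ N = ⨆ i, V i := by
  obtain ⟨m, hm⟩ := hk
  have hk2 : k = 2 * m := by omega
  have hkm : k / 2 = m := by omega
  set w : ℝ := ((k : ℝ) - ((n : ℝ) + 1)) / 2 with hw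
  let μ : ℕ → ℝ := fun j => (w - (j : ℕ) + n) * (n - (w - (j : ℕ) + n))
  let s : ℕ → ℝ := fun j => ((k : ℝ) + n + 1 - 2 * ((j : ℝ) + 1)) / 2
  have hs : ∀ j, μ j = s j * (n - s j) := fun j => by
    simp only [μ, s, hw]; ring
  have hμ : Set.InjOn μ (Set.Iio (k / 2)) := by
    intro i hi j hj h
    have hi' : (i : ℝ) + 1 ≤ m := by exact_mod_cast (hkm ▸ hi : i < m)
    have hj' : (j : ℝ) + 1 ≤ m := by exact_mod_cast (hkm ▸ hj : j < m)
    have hkr : (k : ℝ) = 2 * m := by exact_mod_cast hk2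
    have h1 : ((i : ℝ) - j) * (2 * m - 1 - i - j) = 0 := by
      simp only [hs, s, hkr] at h
      linear_combination h
    rcases mul_eq_zero.1 h1 with h2 | h2
    · exact_mod_cast sub_eq_zero.1 h2
    · linarith
  let φ := (Submodule.orderIsoMapComap (S.densityEquiv w)).symm
  refine ⟨φ (LinearMap.ker (S.scatteringProduct w m)),
    fun i => φ (S.laplacianOp.eigenspace (μ i)), ?_, fun i => ?_, ?_, ?_⟩
  · ext u
    have h1 : u ∈ φ (LinearMap.ker (S.scatteringProduct w m))
        ↔ S.scatteringProduct w m (u.1 S.plusScale) = 0 := Iff.rfl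
    rw [SetLike.mem_coe, h1]
    constructor
    · intro h τ p
      rw [S.gjms_eq_zero_iff (by omega) (by omega) hk2, h]
      rfl
    · intro h
      ext p
      exact (S.gjms_eq_zero_iff (by omega) (by omega) hk2 u S.plusScale p).1 (h _ p)
  · ext u
    have h1 : u ∈ φ (S.laplacianOp.eigenspace (μ i))
        ↔ S.laplacianOp (u.1 S.plusScale) = μ i • u.1 S.plusScale :=
      Module.End.mem_eigenspace_iff
    rw [SetLike.mem_coe, h1, DFunLike.ext_iff]
    refine forall_congr' fun p => ?_
    rw [hs, ← sub_eq_zero]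
    rfl
  · exact ((S.laplacianOp.eigenspaces_iSupIndep).comp
      (f := fun i : Fin (k / 2) => μ i) fun i j h => Fin.ext (hμ i.2 j.2 h)).map_orderIso φ
  · rw [S.scatteringProduct_eq_aeval w m, Module.End.ker_aeval_prod_X_sub_C _ m (hkm ▸ hμ),
      φ.map_iSup, ← hkm]
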